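/- Let $n \ge 2000$, let $V$ be an $n$-dimensional vector space over $\mathbf{F}_2$ with a nondegenerate alternating bilinear form $f$, and let $\mathrm{Sp}_n(2)$ be the isometry group of $f$. A transvection is an element $t \in \mathrm{SL}(V)$ such that $t-1$ has rank one; it has the form $t = 1 + u \otimes \psi$, i.e. $t(x) = x + \psi(x)u$, with $u \in V$, $\psi \in V^*$, $\psi(u)=0$. A set $T$ of transvections is called dense if for all nonzero $v \in V$ and nonzero $\phi \in V^*$ there is some $t = 1 + u\otimes\psi \in T$ with $\phi(u) \ne 0$ and $\psi(v) \ne 0$. For a group $G \le \mathrm{GL}(V)$ let $[V,G]$ be the span of all $gv - v$ ($g \in G$, $v \in V$). For $m \ge 1$ let $S_m$ act on $\mathbf{F}_2^m$ by permuting coordinates, and let $\ell = \langle(1,\dots,1)\rangle$ and $H = \{x : x_1 + \cdots + x_m = 0\}$. A linear group $G \le \mathrm{GL}(U)$ over $\mathbf{F}_2$ has symmetric type if, for some $m$ and some linear isomorphism $U \cong H/(\ell\cap H)$, $G$ corresponds to the image of $S_m$ in $\mathrm{GL}(H/(\ell \cap H))$; it has odd symmetric type if moreover $m$ can be taken odd.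 Let $T \subset \mathrm{Sp}_n(2)$ be a dense set of transvections and let $G = \langle T\rangle$. Then the following are equivalent: (1) $G$ has symmetric type; (2) for every subset $T_0 \subset T$ with $|T_0| \le 1000$ such that, with $G_0 = \langle T_0\rangle$ and $V_0 = [V,G_0]$, we have $\dim V_0 \ge 2$ and $G_0$ acts irreducibly on $V_0$, the restriction $G_0|V_0 \le \mathrm{GL}(V_0)$ has odd symmetric type. -/

import Mathlib

namespace SymType

section Linear

variable {K V : Type*} [Field K] [AddCommGroup V] [Module K V]

/-- A transvection: a linear automorphism `t` of determinant `1` such that `t - 1` has rank one. -/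
def IsTransvection (t : V ≃ₗ[K] V) : Prop :=
  LinearEquiv.det t = 1 ∧
    Module.finrank K (LinearMap.range ((t : V →ₗ[K] V) - LinearMap.id)) = 1

/-- A set `T` of transvections is dense if for all nonzero `v ∈ V` and nonzero `φ ∈ V*` some
`t = 1 + u ⊗ ψ` in `T` (that is, `t x = x + ψ(x) u`) satisfies `φ(u) ≠ 0` and `ψ(v) ≠ 0`. -/
def IsDenseSet (T : Set (V ≃ₗ[K] V)) : Prop :=
  ∀ v : V, v ≠ 0 → ∀ φ : Module.Dual K V, φ ≠ 0 →
    ∃ t ∈ T, ∃ (u : V) (ψ : Module.Dual K V),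
      (∀ x, t x = x + ψ x • u) ∧ φ u ≠ 0 ∧ ψ v ≠ 0

/-- The subspace `[V, G]`, spanned by all `g v - v` with `g ∈ G` and `v ∈ V`. -/
def commutatorSpace (G : Subgroup (V ≃ₗ[K] V)) : Submodule K V :=
  Submodule.span K {x | ∃ g ∈ G, ∃ v : V, x = g v - v}

/-- The restriction `G | W`: the group of all automorphisms of `W` induced by elements of `G`.
(It is used only for `G`-invariant subspaces `W`.) -/
def restrictTo (G : Subgroup (V ≃ₗ[K] V)) (W : Submodule K V) : Subgroup (W ≃ₗ[K] W) where
  carrier := {h | ∃ g ∈ G, ∀ w : W, ((h w : W) : V) = g (w : V)}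
  one_mem' := ⟨1, G.one_mem, fun _ => rfl⟩
  mul_mem' := by
    rintro a b ⟨g, hg, hga⟩ ⟨k, hk, hkb⟩
    refine ⟨g * k, G.mul_mem hg hk, fun w => ?_⟩
    simp only [LinearEquiv.mul_apply, hga, hkb]
  inv_mem' := by
    rintro a ⟨g, hg, hga⟩
    refine ⟨g⁻¹, G.inv_mem hg, fun w => ?_⟩
    apply g.injective
    rw [← hga, ← LinearEquiv.mul_apply, ← LinearEquiv.mul_apply, mul_inv_cancel, mul_inv_cancel]
    rfl

/-- The tautological representation of a linear group `G ≤ GL(V)` on `V`. -/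
def naturalRep (G : Subgroup (V ≃ₗ[K] V)) : Representation K G V where
  toFun g := ((g : V ≃ₗ[K] V) : V →ₗ[K] V)
  map_one' := rfl
  map_mul' _ _ := rfl

end Linear

section Symmetric

/-- The standard permutation representation of `S_m` on `𝔽₂^m`: `(σ x)_i = x_{σ⁻¹ i}`. -/
def permRep (m : ℕ) : Representation (ZMod 2) (Equiv.Perm (Fin m)) (Fin m → ZMod 2) where
  toFun σ := LinearMap.funLeft (ZMod 2) (ZMod 2) (σ⁻¹ : Equiv.Perm (Fin m))
  map_one' := rfl
  map_mul' _ _ := rfl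

/-- The hyperplane `H = {x : x_1 + ⋯ + x_m = 0}` of `𝔽₂^m`. -/
def sumZero (m : ℕ) : Submodule (ZMod 2) (Fin m → ZMod 2) where
  carrier := {x | ∑ i, x i = 0}
  zero_mem' := by simp
  add_mem' := by
    intro a b ha hb
    simp only [Set.mem_ofPred_eq, Pi.add_apply, Finset.sum_add_distrib] at *
    rw [ha, hb, add_zero]
  smul_mem' := by
    intro c a ha
    simp only [Set.mem_ofPred_eq, Pi.smul_apply, ← Finset.smul_sum] at *
    rw [ha, smul_zero]

/-- The line `ℓ` spanned by `e = (1, …, 1)`. -/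
def allOnes (m : ℕ) : Submodule (ZMod 2) (Fin m → ZMod 2) :=
  Submodule.span (ZMod 2) {fun _ => 1}

theorem sumZero_le_comap (m : ℕ) (σ : Equiv.Perm (Fin m)) :
    sumZero m ≤ (sumZero m).comap (permRep m σ) := by
  intro x hx
  change ∑ i, x (σ⁻¹ i) = 0
  rw [Equiv.sum_comp (σ⁻¹ : Equiv.Perm (Fin m)) x]
  exact hx

/-- The action of `S_m` on `H`. -/
def sumZeroRep (m : ℕ) : Representation (ZMod 2) (Equiv.Perm (Fin m)) (sumZero m) :=
  (permRep m).subrepresentation (sumZero m) (sumZero_le_comap m)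

/-- `ℓ ∩ H`, as a subspace of `H`. -/
def allOnesIn (m : ℕ) : Submodule (ZMod 2) (sumZero m) :=
  (allOnes m).comap (sumZero m).subtype

theorem allOnesIn_le_comap (m : ℕ) (σ : Equiv.Perm (Fin m)) :
    allOnesIn m ≤ (allOnesIn m).comap (sumZeroRep m σ) := by
  intro x hx
  obtain ⟨c, hc⟩ := Submodule.mem_span_singleton.1 hx
  refine Submodule.mem_span_singleton.2 ⟨c, ?_⟩
  funext i
  exact congrFun hc (σ⁻¹ i)

/-- The action of `S_m` on `H / (ℓ ∩ H)`. -/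
def symRep (m : ℕ) :
    Representation (ZMod 2) (Equiv.Perm (Fin m)) (sumZero m ⧸ allOnesIn m) :=
  (sumZeroRep m).quotient (allOnesIn m) (allOnesIn_le_comap m)

variable {V : Type*} [AddCommGroup V] [Module (ZMod 2) V]

/-- Under some linear isomorphism `V ≅ H / (ℓ ∩ H)`, the linear group `G ≤ GL(V)` is exactly the
image of `S_m`. -/
def IsSymmetricOfDegree (G : Subgroup (V ≃ₗ[ZMod 2] V)) (m : ℕ) : Prop :=
  ∃ e : V ≃ₗ[ZMod 2] (sumZero m ⧸ allOnesIn m), ∀ g : V ≃ₗ[ZMod 2] V,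
    g ∈ G ↔ ∃ σ : Equiv.Perm (Fin m), ∀ v : V, e (g v) = symRep m σ (e v)

/-- `G` has symmetric type. -/
def HasSymmetricType (G : Subgroup (V ≃ₗ[ZMod 2] V)) : Prop :=
  ∃ m : ℕ, IsSymmetricOfDegree G m

/-- `G` has odd symmetric type. -/
def HasOddSymmetricType (G : Subgroup (V ≃ₗ[ZMod 2] V)) : Prop :=
  ∃ m : ℕ, Odd m ∧ IsSymmetricOfDegree G m

end Symmetric

end SymType

/-! An isometry that is a transvection has the form `x ↦ x + f(x, u) u`, so the theorem concerns
configurations of vectors. In odd degree `k` the vectors `q i = e_i + (1, …, 1)` are pairwise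
non-orthogonal, the transvections of the group are those of the sums `q i + q j`, and two such sums
pair to the parity of the number of shared indices.

Local to global. A set `A` of transvection vectors with connected non-orthogonality graph grows,
inside `T`, to at most `2|A|` vectors with nondegenerate span. The group they generate is
irreducible there, so (2) provides such a system `q` (`exists_isStar_of_isLinked`). Fix `a`, `b`
with `f a b = 1`. In every local system they are pairs `{p, s}` and `{p, t}`, and the pairs through
`p` are recognised from `a` and `b` alone: they are `a`, `b` and the pairs non-orthogonal to both,
except `a + b = {s, t}`. Let `X` be the set of vectors so found in small local systems. Two distinct
members of `X` lie in a common system and share exactly `p`, hence are non-orthogonal. Density joins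
any vector of `T` to `a` through one more vector, so it lies in `X` or is a sum of two members of
`X`. Thus `X` spans `V`, and with `0` as an additional point it exhibits `G` as a symmetric group of
degree `|X| + 1` (`hasSymmetricType_of_star`).

Global to local. As `m > n ≥ 2000`, members of `T` act as transpositions (`exists_eq_swap`), and
1000 of them leave some coordinate `z` unmoved; vectors vanishing at `z` embed in `V`.
Irreducibility puts all the transpositions in one orbit `C`, on which they generate the full
symmetric group. If `|C|` were even, the all-ones vector of `C` would span an invariant line
(`hasOddSymmetricType_of_swaps`). -/

namespace SymType

/-! ### The even-weight model of symmetric type -/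

section Model

variable {m : ℕ}

theorem sumZeroRep_apply (σ : Equiv.Perm (Fin m)) (y : sumZero m) (x : Fin m) :
    (sumZeroRep m σ y : Fin m → ZMod 2) x = (y : Fin m → ZMod 2) (σ⁻¹ x) := rfl

theorem mem_allOnesIn {y : sumZero m} :
    y ∈ allOnesIn m ↔ ∀ i j, (y : Fin m → ZMod 2) i = (y : Fin m → ZMod 2) j := by
  constructor
  · intro hy i j
    obtain ⟨c, hc⟩ := Submodule.mem_span_singleton.1 hy
    have hc' : (fun _ : Fin m => c) = (y : Fin m → ZMod 2) := by
      rw [← show (sumZero m).subtype y = (y : Fin m → ZMod 2) from rfl, ← hc]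
      funext i
      simp
    rw [← hc']
  · intro h
    refine Submodule.mem_span_singleton.2 ?_
    rcases isEmpty_or_nonempty (Fin m) with hm | ⟨⟨i⟩⟩
    · exact ⟨0, funext fun i => hm.elim i⟩
    · refine ⟨(y : Fin m → ZMod 2) i, funext fun j => ?_⟩
      simpa using h i j

/-- The vector `e_i + e_j`. -/
def pairVec (i j : Fin m) : sumZero m :=
  ⟨Pi.single i 1 + Pi.single j 1, by
    change ∑ x, _ = _
    simp only [Pi.add_apply, Finset.sum_add_distrib, Finset.sum_pi_single', Finset.mem_univ,
      if_true]
    decide⟩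

theorem pairVec_apply (i j x : Fin m) : (pairVec i j : Fin m → ZMod 2) x =
    (if x = i then 1 else 0) + if x = j then 1 else 0 := by
  simp [pairVec, Pi.single_apply]

theorem sumZeroRep_pairVec (σ : Equiv.Perm (Fin m)) (i j : Fin m) :
    sumZeroRep m σ (pairVec i j) = pairVec (σ i) (σ j) := by
  ext x
  simp only [sumZeroRep_apply, pairVec_apply, Equiv.Perm.inv_eq_iff_eq]

theorem sumZeroRep_swap {i j : Fin m} (hij : i ≠ j) (y : sumZero m) :
    sumZeroRep m (Equiv.swap i j) y =
      y + ((y : Fin m → ZMod 2) i + (y : Fin m → ZMod 2) j) • pairVec i j := by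
  ext x
  rw [sumZeroRep_apply, Equiv.swap_inv]
  simp only [Submodule.coe_add, Submodule.coe_smul, Pi.add_apply, Pi.smul_apply, pairVec_apply,
    smul_eq_mul]
  generalize hY : (y : Fin m → ZMod 2) = Y
  have h2 : ∀ a b : ZMod 2, a = b + (a + b) := by decide
  by_cases hi : x = i
  · subst hi
    simp [hij, ← add_assoc, CharTwo.add_self_eq_zero]
  · by_cases hj : x = j
    · subst hj
      simp only [Equiv.swap_apply_right, if_neg hi, if_true, zero_add, mul_one]
      exact h2 _ _
    · simp [Equiv.swap_apply_of_ne_of_ne hi hj, hi, hj]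

variable {V : Type*} [AddCommGroup V] [Module (ZMod 2) V]

/-- Replacing the quotient by a surjection from `H` lets every later argument compute with
coordinates. -/
theorem isSymmetricOfDegree_iff {G : Subgroup (V ≃ₗ[ZMod 2] V)} :
    IsSymmetricOfDegree G m ↔ ∃ Φ : sumZero m →ₗ[ZMod 2] V, Function.Surjective Φ ∧
      LinearMap.ker Φ = allOnesIn m ∧ ∀ g : V ≃ₗ[ZMod 2] V,
        g ∈ G ↔ ∃ σ : Equiv.Perm (Fin m), ∀ y, g (Φ y) = Φ (sumZeroRep m σ y) := by
  constructor
  · rintro ⟨e, he⟩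
    refine ⟨e.symm.toLinearMap ∘ₗ (allOnesIn m).mkQ, ?_, ?_, fun g => ?_⟩
    · exact e.symm.surjective.comp (Submodule.mkQ_surjective _)
    · rw [LinearMap.ker_comp, LinearEquiv.ker, Submodule.comap_bot, Submodule.ker_mkQ]
    · rw [he]
      refine exists_congr fun σ => ⟨fun h y => ?_, fun h v => ?_⟩
      · apply e.injective
        simp only [LinearMap.comp_apply, LinearEquiv.coe_coe, h, LinearEquiv.apply_symm_apply]
        rfl
      · obtain ⟨y, hy⟩ := Submodule.mkQ_surjective _ (e v)
        have := h y
        simp only [LinearMap.comp_apply, LinearEquiv.coe_coe, hy, LinearEquiv.symm_apply_apply]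
          at this
        rw [this, ← hy, LinearEquiv.apply_symm_apply]
        rfl
  · rintro ⟨Φ, hsurj, hker, hG⟩
    let e := (Submodule.quotEquivOfEq _ _ hker.symm).trans (Φ.quotKerEquivOfSurjective hsurj)
    have he : ∀ y, e (Submodule.Quotient.mk y) = Φ y := fun y => rfl
    refine ⟨e.symm, fun g => ?_⟩
    rw [hG]
    refine exists_congr fun σ => ⟨fun h v => ?_, fun h y => ?_⟩
    · obtain ⟨y, rfl⟩ := hsurj v
      rw [h, LinearEquiv.symm_apply_eq, ← he y, LinearEquiv.symm_apply_apply, ← he]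
      rfl
    · have := h (Φ y)
      rw [LinearEquiv.symm_apply_eq, ← he y, LinearEquiv.symm_apply_apply] at this
      rw [← he y, this, ← he]
      rfl

theorem exists_equiv_of_perm (Φ : sumZero m →ₗ[ZMod 2] V) (hsurj : Function.Surjective Φ)
    (hker : LinearMap.ker Φ = allOnesIn m) (σ : Equiv.Perm (Fin m)) :
    ∃ g : V ≃ₗ[ZMod 2] V, ∀ y, g (Φ y) = Φ (sumZeroRep m σ y) := by
  let e := (Submodule.quotEquivOfEq _ _ hker.symm).trans (Φ.quotKerEquivOfSurjective hsurj)
  have he : ∀ y, e (Submodule.Quotient.mk y) = Φ y := fun y => rfl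
  have hmul : ∀ τ : Equiv.Perm (Fin m), symRep m τ ∘ₗ symRep m τ⁻¹ = LinearMap.id := fun τ => by
    rw [← Module.End.mul_eq_comp, ← map_mul, mul_inv_cancel, map_one]
    rfl
  let s : (sumZero m ⧸ allOnesIn m) ≃ₗ[ZMod 2] (sumZero m ⧸ allOnesIn m) :=
    LinearEquiv.ofLinearMap (symRep m σ) (symRep m σ⁻¹) (hmul σ) (by simpa using hmul σ⁻¹)
  refine ⟨(e.symm.trans s).trans e, fun y => ?_⟩
  change e (s (e.symm (Φ y))) = _
  rw [← he y, LinearEquiv.symm_apply_apply, ← he]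
  rfl

/-- Transpositions generate `S_m`, and an automorphism is determined by its effect on the image of
`Φ`. -/
theorem isSymmetricOfDegree_of_swaps {G : Subgroup (V ≃ₗ[ZMod 2] V)}
    (Φ : sumZero m →ₗ[ZMod 2] V) (hsurj : Function.Surjective Φ)
    (hker : LinearMap.ker Φ = allOnesIn m)
    (hperm : ∀ g ∈ G, ∃ σ : Equiv.Perm (Fin m), ∀ y, g (Φ y) = Φ (sumZeroRep m σ y))
    (hswap : ∀ i j : Fin m, i ≠ j → ∃ g ∈ G, ∀ y, g (Φ y) = Φ (sumZeroRep m (Equiv.swap i j) y)) :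
    IsSymmetricOfDegree G m := by
  refine isSymmetricOfDegree_iff.2 ⟨Φ, hsurj, hker, fun g => ⟨hperm g, ?_⟩⟩
  rintro ⟨σ, hσ⟩
  have key : ∀ σ : Equiv.Perm (Fin m), ∃ g ∈ G, ∀ y, g (Φ y) = Φ (sumZeroRep m σ y) := by
    intro σ
    induction σ using Equiv.Perm.swap_induction_on with
    | one => exact ⟨1, G.one_mem, fun y => by simp⟩
    | swap_mul σ i j hij ih =>
      obtain ⟨g, hg, h⟩ := ih
      obtain ⟨k, hk, h'⟩ := hswap i j hij
      refine ⟨k * g, G.mul_mem hk hg, fun y => ?_⟩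
      rw [LinearEquiv.mul_apply, h, h', map_mul]
      rfl
  obtain ⟨k, hk, h⟩ := key σ
  have : g = k := by
    ext v
    obtain ⟨y, rfl⟩ := hsurj v
    rw [hσ, h]
  rwa [this]

/-- If every generator of a group permutes coordinates, then so does every element. -/
theorem exists_perm_of_mem_closure (Φ : sumZero m →ₗ[ZMod 2] V) {T : Set (V ≃ₗ[ZMod 2] V)}
    (K : Subgroup (Equiv.Perm (Fin m)))
    (hT : ∀ g ∈ T, ∃ σ ∈ K, ∀ y, g (Φ y) = Φ (sumZeroRep m σ y))
    {g : V ≃ₗ[ZMod 2] V} (hg : g ∈ Subgroup.closure T) :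
    ∃ σ ∈ K, ∀ y, g (Φ y) = Φ (sumZeroRep m σ y) := by
  induction hg using Subgroup.closure_induction with
  | mem g hg => exact hT g hg
  | one => exact ⟨1, K.one_mem, fun y => by simp⟩
  | mul g k _ _ ihg ihk =>
    obtain ⟨σ, hσK, hσ⟩ := ihg
    obtain ⟨τ, hτK, hτ⟩ := ihk
    refine ⟨σ * τ, K.mul_mem hσK hτK, fun y => ?_⟩
    rw [LinearEquiv.mul_apply, hτ, hσ, map_mul]
    rfl
  | inv g _ ih =>
    obtain ⟨σ, hσK, hσ⟩ := ih
    refine ⟨σ⁻¹, K.inv_mem hσK, fun y => ?_⟩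
    apply g.injective
    rw [← LinearEquiv.mul_apply, mul_inv_cancel, hσ, ← Module.End.mul_apply, ← map_mul,
      mul_inv_cancel]
    simp

end Model

/-! ### Transvections preserving the form -/

section Transvections

variable {V : Type*} [AddCommGroup V] [Module (ZMod 2) V]
  {f : LinearMap.BilinForm (ZMod 2) V}

theorem eq_one_of_ne_zero {a : ZMod 2} (ha : a ≠ 0) : a = 1 := by
  revert a; decide

theorem add_self (v : V) : v + v = 0 := by
  rw [← two_smul (ZMod 2) v, show (2 : ZMod 2) = 0 from rfl, zero_smul]

theorem form_comm (hf : f.IsAlt) (x y : V) : f x y = f y x := by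
  rw [← hf.neg_eq]
  exact ZMod.neg_eq_self_mod_two _

/-- The transvection `x ↦ x + f(x, u) u`. -/
def formTransvection (hf : f.IsAlt) (u : V) : V ≃ₗ[ZMod 2] V :=
  LinearEquiv.transvection (f := f.flip u) (v := u) (hf u)

theorem formTransvection_apply (hf : f.IsAlt) (u x : V) :
    formTransvection hf u x = x + f x u • u := rfl

theorem exists_form_ne_zero (hnd : f.Nondegenerate) {u : V} (hu : u ≠ 0) :
    ∃ x, f x u = 1 := by
  by_contra! h
  exact hu (hnd.2 u fun x => by
    by_contra hx
    exact h x (eq_one_of_ne_zero hx))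

/-- Comparing `f (t x) (t y)` with `f x y`, where `f y u = 1`, forces `ψ x = ψ y * f x u`; the
scalar `ψ y` is 1 because `t ≠ 1`. -/
theorem exists_eq_formTransvection (hf : f.IsAlt) (hnd : f.Nondegenerate) {t : V ≃ₗ[ZMod 2] V}
    (ht : IsTransvection t) (htf : ∀ x y, f (t x) (t y) = f x y) :
    ∃ u ≠ 0, t = formTransvection hf u := by
  obtain ⟨⟨u, hur⟩, hu0, hspan⟩ := finrank_eq_one_iff'.1 ht.2
  have hu : u ≠ 0 := fun h => hu0 (Subtype.ext h)
  have hex : ∀ x, ∃ c : ZMod 2, t x = x + c • u := by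
    intro x
    obtain ⟨c, hc⟩ := hspan ⟨_, LinearMap.mem_range_self _ x⟩
    have hc := congrArg Subtype.val hc
    refine ⟨c, ?_⟩
    change c • u = t x - x at hc
    rw [hc]; abel
  choose ψ hψ using hex
  obtain ⟨y, hy⟩ := exists_form_ne_zero hnd hu
  have hrel : ∀ x, ψ x = ψ y * f x u := by
    intro x
    have h := htf x y
    rw [hψ x, hψ y] at h
    simp only [map_add, map_smul, LinearMap.add_apply, LinearMap.smul_apply, smul_eq_mul,
      hf u, mul_zero, add_zero, form_comm hf u y, hy, mul_one] at h
    have h2 : ∀ a b c : ZMod 2, a + b + c = a → b = c := by decide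
    exact h2 _ _ _ h
  have hψy : ψ y = 1 := by
    apply eq_one_of_ne_zero
    intro h0
    obtain ⟨x, hx⟩ := hur
    change t x - x = u at hx
    rw [hψ x, hrel x, h0, zero_mul, zero_smul, add_zero, sub_self] at hx
    exact hu hx.symm
  refine ⟨u, hu, LinearEquiv.ext fun x => ?_⟩
  rw [hψ, hrel, hψy, one_mul, formTransvection_apply]

theorem exists_mem_of_isDenseSet (hf : f.IsAlt) (hnd : f.Nondegenerate)
    {T : Set (V ≃ₗ[ZMod 2] V)}
    (hT : ∀ t ∈ T, ∃ u ≠ 0, t = formTransvection hf u) (hdense : IsDenseSet T)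
    {v w : V} (hv : v ≠ 0) (hw : w ≠ 0) :
    ∃ u, formTransvection hf u ∈ T ∧ f u v = 1 ∧ f u w = 1 := by
  obtain ⟨t, htT, u, ψ, ht, h1, h2⟩ := hdense v hv (f.flip w) (fun h => by
    obtain ⟨x, hx⟩ := exists_form_ne_zero hnd hw
    have := LinearMap.congr_fun h x
    change f x w = 0 at this
    exact one_ne_zero (hx.symm.trans this))
  obtain ⟨u', hu', rfl⟩ := hT t htT
  have huu : u = u' := by
    obtain ⟨x, hx⟩ := exists_form_ne_zero hnd hu'
    have := ht x
    rw [formTransvection_apply, hx, one_smul, add_right_inj] at this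
    by_cases h0 : ψ x = 0
    · rw [h0, zero_smul] at this
      exact absurd this hu'
    · rw [eq_one_of_ne_zero h0, one_smul] at this
      exact this.symm
  subst huu
  refine ⟨u, htT, ?_, eq_one_of_ne_zero h1⟩
  have := ht v
  rw [formTransvection_apply, add_right_inj, eq_one_of_ne_zero h2, one_smul] at this
  rw [form_comm hf]
  refine eq_one_of_ne_zero fun h0 => hu' ?_
  rw [← this, h0, zero_smul]

end Transvections

end SymType

namespace SymType

variable {V : Type*} [AddCommGroup V] [Module (ZMod 2) V]
  {f : LinearMap.BilinForm (ZMod 2) V}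

/-! ### Groups generated by transvections -/

section Groups

theorem form_formTransvection (hf : f.IsAlt) (u x y : V) :
    f (formTransvection hf u x) (formTransvection hf u y) = f x y := by
  simp only [formTransvection_apply, map_add, map_smul, LinearMap.add_apply, LinearMap.smul_apply,
    smul_eq_mul, hf u, mul_zero, add_zero, form_comm hf u y]
  have : ∀ a b c : ZMod 2, a + b * c + c * b = a := by decide
  exact this _ _ _

theorem form_apply_of_mem_closure (hf : f.IsAlt) {B : Set V} {g : V ≃ₗ[ZMod 2] V}
    (hg : g ∈ Subgroup.closure (formTransvection hf '' B)) (x y : V) : f (g x) (g y) = f x y := by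
  induction hg using Subgroup.closure_induction generalizing x y with
  | mem g hg =>
    obtain ⟨u, -, rfl⟩ := hg
    exact form_formTransvection hf u x y
  | one => rfl
  | mul g k _ _ ihg ihk => rw [LinearEquiv.mul_apply, LinearEquiv.mul_apply, ihg, ihk]
  | inv g _ ih =>
    rw [← ih, ← LinearEquiv.mul_apply, ← LinearEquiv.mul_apply, mul_inv_cancel]
    rfl

/-- Conjugating the transvection of `b` by that of `a` gives the transvection of the image of `b`,
which is `a + b`. -/
theorem formTransvection_add_mem (hf : f.IsAlt) {G : Subgroup (V ≃ₗ[ZMod 2] V)} {a b : V}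
    (ha : formTransvection hf a ∈ G) (hb : formTransvection hf b ∈ G) (hab : f a b = 1) :
    formTransvection hf (a + b) ∈ G := by
  have h : formTransvection hf (a + b) =
      formTransvection hf a * formTransvection hf b * (formTransvection hf a)⁻¹ := by
    rw [eq_mul_inv_iff_mul_eq]
    ext x
    have hba : formTransvection hf a b = a + b := by
      rw [formTransvection_apply, form_comm hf, hab, one_smul, add_comm]
    rw [LinearEquiv.mul_apply, LinearEquiv.mul_apply, formTransvection_apply hf (a + b), ← hba,
      form_formTransvection, formTransvection_apply hf b, map_add, map_smul]
  rw [h]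
  exact G.mul_mem (G.mul_mem ha hb) (G.inv_mem ha)

theorem sub_mem_of_mem_closure {T : Set (V ≃ₗ[ZMod 2] V)} {W : Submodule (ZMod 2) V}
    (hT : ∀ t ∈ T, ∀ v, t v - v ∈ W) {g : V ≃ₗ[ZMod 2] V} (hg : g ∈ Subgroup.closure T) (v : V) :
    g v - v ∈ W := by
  induction hg using Subgroup.closure_induction generalizing v with
  | mem g hg => exact hT g hg v
  | one => simp
  | mul g k _ _ ihg ihk =>
    rw [LinearEquiv.mul_apply, ← sub_add_sub_cancel (g (k v)) (k v) v]
    exact W.add_mem (ihg _) (ihk _)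
  | inv g _ ih =>
    have := W.neg_mem (ih (g⁻¹ v))
    rwa [← LinearEquiv.mul_apply, mul_inv_cancel, neg_sub] at this

theorem commutatorSpace_closure_formTransvection (hf : f.IsAlt) (hnd : f.Nondegenerate)
    (B : Set V) :
    commutatorSpace (Subgroup.closure (formTransvection hf '' B)) =
      Submodule.span (ZMod 2) B := by
  apply le_antisymm
  · refine Submodule.span_le.2 ?_
    rintro _ ⟨g, hg, v, rfl⟩
    refine sub_mem_of_mem_closure ?_ hg v
    rintro _ ⟨u, hu, rfl⟩ v
    rw [formTransvection_apply, add_sub_cancel_left]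
    exact Submodule.smul_mem _ _ (Submodule.subset_span hu)
  · refine Submodule.span_le.2 fun u hu => ?_
    by_cases h0 : u = 0
    · rw [h0]
      exact Submodule.zero_mem _
    · obtain ⟨x, hx⟩ := exists_form_ne_zero hnd h0
      refine Submodule.subset_span ⟨_, Subgroup.subset_closure ⟨u, hu, rfl⟩, x, ?_⟩
      rw [formTransvection_apply, hx, one_smul, add_sub_cancel_left]

theorem apply_eq_of_mem_orthogonal (hf : f.IsAlt) {B : Set V} {g : V ≃ₗ[ZMod 2] V}
    (hg : g ∈ Subgroup.closure (formTransvection hf '' B)) {x : V}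
    (hx : x ∈ f.orthogonal (Submodule.span (ZMod 2) B)) : g x = x := by
  induction hg using Subgroup.closure_induction with
  | mem g hg =>
    obtain ⟨u, hu, rfl⟩ := hg
    have : f u x = 0 := hx u (Submodule.subset_span hu)
    rw [formTransvection_apply, form_comm hf, this, zero_smul, add_zero]
  | one => rfl
  | mul g k _ _ ihg ihk => rw [LinearEquiv.mul_apply, ihk, ihg]
  | inv g _ ih =>
    apply g.injective
    rw [← LinearEquiv.mul_apply, mul_inv_cancel, ih]
    rfl

theorem restrict_isAlt (hf : f.IsAlt) (W : Submodule (ZMod 2) V) : (f.restrict W).IsAlt :=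
  fun x => hf x

theorem restrict_formTransvection_mem (hf : f.IsAlt) {G : Subgroup (V ≃ₗ[ZMod 2] V)}
    {W : Submodule (ZMod 2) V} {u : V} (huW : u ∈ W) (hu : formTransvection hf u ∈ G) :
    formTransvection (restrict_isAlt hf W) ⟨u, huW⟩ ∈ restrictTo G W :=
  ⟨_, hu, fun _ => rfl⟩

end Groups

/-! ### Connected sets of vectors, nondegenerate spans and irreducibility -/

section Linked

/-- A finite set of vectors is linked if its non-orthogonality graph is connected. -/
def IsLinked (f : LinearMap.BilinForm (ZMod 2) V) (B : Finset V) : Prop :=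
  ∀ P : V → Prop, (∃ u ∈ B, P u) → (∀ u ∈ B, ∀ w ∈ B, P u → f u w = 1 → P w) → ∀ u ∈ B, P u

theorem isLinked_singleton (a : V) : IsLinked f {a} := by
  rintro P ⟨u, hu, hPu⟩ - w hw
  rw [Finset.mem_singleton] at hu hw
  rwa [hw, ← hu]

open Classical in
theorem IsLinked.union {A B : Finset V} (hA : IsLinked f A) (hB : IsLinked f B) {a : V}
    (haA : a ∈ A) (haB : a ∈ B) : IsLinked f (A ∪ B) := by
  rintro P ⟨u, hu, hPu⟩ hP
  have hPA : (∃ u ∈ A, P u) → ∀ u ∈ A, P u := fun h => hA P h fun u hu w hw =>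
    hP u (Finset.mem_union_left _ hu) w (Finset.mem_union_left _ hw)
  have hPB : (∃ u ∈ B, P u) → ∀ u ∈ B, P u := fun h => hB P h fun u hu w hw =>
    hP u (Finset.mem_union_right _ hu) w (Finset.mem_union_right _ hw)
  have hPa : P a := by
    rcases Finset.mem_union.1 hu with h | h
    · exact hPA ⟨u, h, hPu⟩ a haA
    · exact hPB ⟨u, h, hPu⟩ a haB
  intro w hw
  rcases Finset.mem_union.1 hw with h | h
  · exact hPA ⟨a, haA, hPa⟩ w h
  · exact hPB ⟨a, haB, hPa⟩ w h

open Classical in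
theorem IsLinked.insert (hf : f.IsAlt) {A : Finset V} (hA : IsLinked f A) {w u : V} (hw : w ∈ A)
    (hwu : f w u = 1) : IsLinked f (insert u A) := by
  rintro P ⟨x, hx, hPx⟩ hP
  have hPA : (∃ u ∈ A, P u) → ∀ u ∈ A, P u := fun h => hA P h fun u hu w hw =>
    hP u (Finset.mem_insert_of_mem hu) w (Finset.mem_insert_of_mem hw)
  have hPw : P w := by
    rcases Finset.mem_insert.1 hx with rfl | h
    · exact hP x (Finset.mem_insert_self _ _) w (Finset.mem_insert_of_mem hw) hPx
        (by rw [form_comm hf, hwu])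
    · exact hPA ⟨x, h, hPx⟩ w hw
  intro y hy
  rcases Finset.mem_insert.1 hy with rfl | h
  · exact hP w (Finset.mem_insert_of_mem hw) y (Finset.mem_insert_self _ _) hPw hwu
  · exact hPA ⟨w, hw, hPw⟩ y h

-- Adjoin a `u ∈ S` not orthogonal to some `r ≠ 0` in the radical of the span. The new radical lies
-- in the old one and omits `r`, so its dimension drops at each step.
open Classical in
theorem exists_linked_disjoint_orthogonal [FiniteDimensional (ZMod 2) V] (hf : f.IsAlt)
    {S : Set V} (hS : ∀ r, r ≠ 0 → ∃ u ∈ S, f u r = 1) (d : ℕ) (A : Finset V)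
    (hAS : (A : Set V) ⊆ S) (hA : IsLinked f A)
    (hd : Module.finrank (ZMod 2) (Submodule.span (ZMod 2) (A : Set V) ⊓
      f.orthogonal (Submodule.span (ZMod 2) (A : Set V)) : Submodule (ZMod 2) V) ≤ d) :
    ∃ B : Finset V, A ⊆ B ∧ (B : Set V) ⊆ S ∧ IsLinked f B ∧ B.card ≤ A.card + d ∧
      Disjoint (Submodule.span (ZMod 2) (B : Set V))
        (f.orthogonal (Submodule.span (ZMod 2) (B : Set V))) := by
  induction d generalizing A with
  | zero =>
    refine ⟨A, subset_rfl, hAS, hA, le_rfl, ?_⟩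
    rw [disjoint_iff]
    exact Submodule.finrank_eq_zero.1 (Nat.le_zero.1 hd)
  | succ d ih =>
    by_cases hdis : Disjoint (Submodule.span (ZMod 2) (A : Set V))
        (f.orthogonal (Submodule.span (ZMod 2) (A : Set V)))
    · exact ⟨A, subset_rfl, hAS, hA, by lia, hdis⟩
    rw [disjoint_iff, Submodule.eq_bot_iff] at hdis
    push Not at hdis
    obtain ⟨r, ⟨hrW, hrO⟩, hr0⟩ := hdis
    obtain ⟨u, huS, hur⟩ := hS r hr0
    -- If `u` were orthogonal to all of `A`, it would be orthogonal to `r`, which lies in the span.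
    obtain ⟨w, hwA, hwu⟩ : ∃ w ∈ A, f w u = 1 := by
      by_contra! h
      have : Submodule.span (ZMod 2) (A : Set V) ≤ LinearMap.ker (f u) :=
        Submodule.span_le.2 fun w hw => by
          by_contra hne
          exact h w hw (by rw [form_comm hf]; exact eq_one_of_ne_zero hne)
      exact one_ne_zero (hur.symm.trans (this hrW))
    obtain ⟨B, hB, hB'⟩ := ih (insert u A)
      (by rw [Finset.coe_insert]; exact Set.insert_subset huS hAS)
      (hA.insert hf hwA hwu) (by
        rw [← Nat.lt_succ_iff]
        refine lt_of_lt_of_le (Submodule.finrank_lt_finrank_of_lt ?_) hd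
        rw [SetLike.lt_iff_le_and_exists]
        have hsub : Submodule.span (ZMod 2) (A : Set V) ≤
            Submodule.span (ZMod 2) ((insert u A : Finset V) : Set V) :=
          Submodule.span_mono (by simp)
        refine ⟨?_, r, ⟨hrW, hrO⟩, fun h => ?_⟩
        · rintro x ⟨hx, hxO⟩
          refine ⟨?_, fun y hy => hxO y (hsub hy)⟩
          have hrx : f r x = 0 := hxO r (hsub hrW)
          rw [Finset.coe_insert] at hx
          obtain ⟨c, y, hy, rfl⟩ := Submodule.mem_span_insert.1 hx
          have hyr : f y r = 0 := hrO y hy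
          rw [map_add, map_smul, form_comm hf r y, hyr, form_comm hf r u, hur, smul_eq_mul,
            mul_one, add_zero] at hrx
          rwa [hrx, zero_smul, zero_add]
        · have : f u r = 0 := h.2 u (Submodule.subset_span (by simp))
          exact one_ne_zero (hur.symm.trans this))
    refine ⟨B, (Finset.subset_insert _ _).trans hB, hB'.1, hB'.2.1, ?_, hB'.2.2.2⟩
    have := Finset.card_insert_le u A
    have := hB'.2.2.1
    lia

/-- A nonzero `w` in an invariant subspace is non-orthogonal to some `u ∈ B`, as the radical is
zero; the transvection of `u` moves `w` by `u`, so `u` belongs to the subspace, and connectedness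
spreads this to all of `B`. -/
theorem isIrreducible_of_isLinked (hf : f.IsAlt) {B : Finset V} (hB : IsLinked f B)
    (hdis : Disjoint (Submodule.span (ZMod 2) (B : Set V))
      (f.orthogonal (Submodule.span (ZMod 2) (B : Set V))))
    (hne : Submodule.span (ZMod 2) (B : Set V) ≠ ⊥) :
    (naturalRep (restrictTo (Subgroup.closure (formTransvection hf '' (B : Set V)))
      (Submodule.span (ZMod 2) (B : Set V)))).IsIrreducible := by
  set W := Submodule.span (ZMod 2) (B : Set V) with hW
  have : Nontrivial W := Submodule.nontrivial_iff_ne_bot.2 hne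
  have hstep : ∀ ρ : Subrepresentation (naturalRep (restrictTo (Subgroup.closure
      (formTransvection hf '' (B : Set V))) W)), ∀ w ∈ ρ.toSubmodule, ∀ u (hu : u ∈ B),
      f w u = 1 → (⟨u, Submodule.subset_span hu⟩ : W) ∈ ρ.toSubmodule := by
    intro ρ w hw u hu hwu
    have h := ρ.apply_mem_toSubmodule ⟨_, restrict_formTransvection_mem hf
      (Submodule.subset_span hu) (Subgroup.subset_closure ⟨u, hu, rfl⟩)⟩ hw
    have h' := ρ.toSubmodule.sub_mem h hw
    convert h' using 1
    ext
    change u = (w : V) + f w u • u - w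
    rw [hwu, one_smul, add_sub_cancel_left]
  refine { exists_pair_ne := ⟨⊥, ⊤, fun h => ?_⟩, eq_bot_or_eq_top := fun ρ => ?_ }
  · have := congrArg Subrepresentation.toSubmodule h
    exact bot_ne_top this
  · rw [or_iff_not_imp_left]
    intro hρ
    have hρ' : ρ.toSubmodule ≠ ⊥ := fun h => hρ (Subrepresentation.toSubmodule_injective h)
    obtain ⟨w, hw, hw0⟩ := Submodule.exists_mem_ne_zero_of_ne_bot hρ'
    obtain ⟨u, huB, hwu⟩ : ∃ u ∈ B, f w u = 1 := by
      by_contra! h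
      have hle : W ≤ LinearMap.ker (f w) := Submodule.span_le.2 fun u hu => by
        by_contra hne
        exact h u hu (eq_one_of_ne_zero hne)
      refine hw0 (Subtype.ext (Submodule.disjoint_def.1 hdis w w.2 fun y hy => ?_))
      change f y w = 0
      rw [form_comm hf]
      exact hle hy
    have hall := hB (fun x => ∃ hx : x ∈ W, (⟨x, hx⟩ : W) ∈ ρ.toSubmodule)
      ⟨u, huB, _, hstep ρ w hw u huB hwu⟩
      fun x _ y hy ⟨_, hx⟩ hxy => ⟨_, hstep ρ _ hx y hy hxy⟩
    apply Subrepresentation.toSubmodule_injective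
    have hle : W ≤ ρ.toSubmodule.map W.subtype := Submodule.span_le.2 fun x hx => by
      obtain ⟨hxW, hx'⟩ := hall x hx
      exact ⟨_, hx', rfl⟩
    change ρ.toSubmodule = ⊤
    rw [eq_top_iff]
    rintro ⟨x, hx⟩ -
    obtain ⟨y, hy, hyx⟩ := hle hx
    have : y = ⟨x, hx⟩ := Subtype.ext hyx
    rwa [← this]

end Linked

end SymType

namespace SymType

variable {V : Type*} [AddCommGroup V] [Module (ZMod 2) V]
  {f : LinearMap.BilinForm (ZMod 2) V}

/-! ### Odd degree: a spanning family permuted by `S_k` -/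

section OddModel

variable {k : ℕ}

/-- The vector `e_i + (1, …, 1)`, which has even weight when `k` is odd. -/
def coPoint (hk : Odd k) (i : Fin k) : sumZero k :=
  ⟨Pi.single i 1 + fun _ => 1, by
    change ∑ x, _ = _
    simp only [Pi.add_apply, Finset.sum_add_distrib, Finset.sum_pi_single', Finset.mem_univ,
      if_true, Finset.sum_const, Finset.card_univ, Fintype.card_fin, nsmul_eq_mul, mul_one]
    rw [(ZMod.natCast_eq_one_iff_odd).2 hk]
    decide⟩

theorem coPoint_apply (hk : Odd k) (i x : Fin k) :
    (coPoint hk i : Fin k → ZMod 2) x = (if x = i then 1 else 0) + 1 := by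
  simp [coPoint, Pi.single_apply]

theorem sumZeroRep_coPoint (hk : Odd k) (σ : Equiv.Perm (Fin k)) (i : Fin k) :
    sumZeroRep k σ (coPoint hk i) = coPoint hk (σ i) := by
  ext x
  simp only [sumZeroRep_apply, coPoint_apply, Equiv.Perm.inv_eq_iff_eq]

/-- The all-ones parts cancel because the coordinates of `y` sum to zero. -/
theorem sum_smul_coPoint (hk : Odd k) (y : sumZero k) :
    ∑ i, (y : Fin k → ZMod 2) i • coPoint hk i = y := by
  ext x
  have hy : ∑ i, (y : Fin k → ZMod 2) i = 0 := y.2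
  simp [coPoint_apply, mul_add, Finset.sum_add_distrib, hy]

theorem exists_perm_apply_eq {α : Type*} [DecidableEq α] {i j i' j' : α} (h : i ≠ j)
    (h' : i' ≠ j') : ∃ σ : Equiv.Perm α, σ i = i' ∧ σ j = j' := by
  refine ⟨Equiv.swap (Equiv.swap i i' j) j' * Equiv.swap i i', ?_, ?_⟩
  · rw [Equiv.Perm.mul_apply, Equiv.swap_apply_left]
    refine Equiv.swap_apply_of_ne_of_ne (fun hh => h ?_) h'
    rw [← (Equiv.swap i i').injective.eq_iff, ← hh, Equiv.swap_apply_left]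
  · rw [Equiv.Perm.mul_apply, Equiv.swap_apply_left]

end OddModel

/-! ### Star systems and the combinatorics of pairs -/

section PairSystem

/-- A family of vectors in which any two distinct members are non-orthogonal. The sums of two
distinct members pair under the form as the vectors `e_i + e_j` do under the dot product. -/
def IsStar (f : LinearMap.BilinForm (ZMod 2) V) {k : ℕ} (q : Fin k → V) : Prop :=
  ∀ i j, f (q i) (q j) = if i = j then 0 else 1

variable {k : ℕ} {q : Fin k → V}

/-- Modulo 2 the right side is the parity of the number of coincidences between `i, j` and `x, y`.
-/
theorem IsStar.form_pair (hq : IsStar f q) (i j x y : Fin k) :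
    f (q i + q j) (q x + q y) = (if i = x then 0 else 1) + (if i = y then 0 else 1) +
      ((if j = x then 0 else 1) + (if j = y then 0 else 1)) := by
  simp only [map_add, LinearMap.add_apply, hq _ _]
  ring

theorem IsStar.exists_common (hq : IsStar f q) {i j x y : Fin k} (hij : i ≠ j) (hxy : x ≠ y)
    (h : f (q i + q j) (q x + q y) = 1) :
    ∃ p s t, p ≠ s ∧ p ≠ t ∧ s ≠ t ∧ q i + q j = q p + q s ∧ q x + q y = q p + q t := by
  rw [hq.form_pair] at h
  by_cases h1 : i = x
  · subst h1
    refine ⟨i, j, y, hij, hxy, fun h3 => ?_, rfl, rfl⟩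
    subst h3
    simp [hij, hij.symm, CharTwo.add_self_eq_zero] at h
  by_cases h3 : i = y
  · subst h3
    refine ⟨i, j, x, hij, h1, fun h3 => ?_, rfl, add_comm _ _⟩
    subst h3
    simp [hij, hij.symm, CharTwo.add_self_eq_zero] at h
  by_cases h4 : j = x
  · subst h4
    exact ⟨j, i, y, hij.symm, hxy, h3, add_comm _ _, rfl⟩
  by_cases h5 : j = y
  · subst h5
    exact ⟨j, i, x, hij.symm, h4, h1, add_comm _ _, add_comm _ _⟩
  simp [h1, h3, h4, h5, CharTwo.add_self_eq_zero] at h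

/-- A pair avoiding `p` that meets both `{p, s}` and `{p, t}` in one point is `{s, t}`, which is
excluded. -/
theorem IsStar.exists_eq_add (hq : IsStar f q) {p s t x y : Fin k} (hps : p ≠ s) (hpt : p ≠ t)
    (hst : s ≠ t) (hxy : x ≠ y) (hs : f (q x + q y) (q p + q s) = 1)
    (ht : f (q x + q y) (q p + q t) = 1) (hne : q x + q y ≠ q s + q t) :
    ∃ z, p ≠ z ∧ q x + q y = q p + q z := by
  by_cases hx : x = p
  · exact ⟨y, hx ▸ hxy, by rw [hx]⟩
  by_cases hy : y = p
  · exact ⟨x, fun h => hx h.symm, by rw [hy, add_comm]⟩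
  exfalso
  rw [hq.form_pair] at hs ht
  by_cases h1 : x = s
  · subst h1
    by_cases h2 : y = t
    · subst h2
      exact hne rfl
    · simp [hx, hy, hst, h2, CharTwo.add_self_eq_zero] at ht
  · by_cases h2 : y = s
    · subst h2
      by_cases h3 : x = t
      · subst h3
        exact hne (add_comm _ _)
      · simp [hx, hy, hst, h3, CharTwo.add_self_eq_zero] at ht
    · simp [hx, hy, h1, h2, CharTwo.add_self_eq_zero] at hs

/-- The family `q` is the image of the vectors `coPoint`, which the group permutes by isometries. -/
theorem exists_isStar_of_hasOddSymmetricType [FiniteDimensional (ZMod 2) V] (hf : f.IsAlt)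
    (hnd : f.Nondegenerate) {B : Set V}
    (hdis : Disjoint (Submodule.span (ZMod 2) B) (f.orthogonal (Submodule.span (ZMod 2) B)))
    (hne : Submodule.span (ZMod 2) B ≠ ⊥)
    (hodd : HasOddSymmetricType (restrictTo (Subgroup.closure (formTransvection hf '' B))
      (Submodule.span (ZMod 2) B))) :
    ∃ (k : ℕ) (q : Fin k → V), IsStar f q ∧ ∀ c, c ≠ 0 →
      (formTransvection hf c ∈ Subgroup.closure (formTransvection hf '' B) ↔
        ∃ i j, i ≠ j ∧ c = q i + q j) := by
  set W := Submodule.span (ZMod 2) B with hW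
  obtain ⟨k, hk, hsym⟩ := hodd
  obtain ⟨Φ, hsurj, hker, hG⟩ := isSymmetricOfDegree_iff.1 hsym
  let q : Fin k → V := fun i => (Φ (coPoint hk i) : V)
  have hspan : ∀ x ∈ W, ∃ y : Fin k → ZMod 2, x = ∑ i, y i • q i := by
    intro x hx
    obtain ⟨y, hy⟩ := hsurj ⟨x, hx⟩
    refine ⟨y, ?_⟩
    have hy := congrArg Subtype.val hy
    rw [← sum_smul_coPoint hk y, map_sum] at hy
    simpa [q] using hy.symm
  have hperm : ∀ σ : Equiv.Perm (Fin k), ∃ g ∈ Subgroup.closure (formTransvection hf '' B),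
      ∀ i, g (q i) = q (σ i) := by
    intro σ
    obtain ⟨h, hh⟩ := exists_equiv_of_perm Φ hsurj hker σ
    obtain ⟨g, hg, hgh⟩ := (hG h).2 ⟨σ, hh⟩
    refine ⟨g, hg, fun i => ?_⟩
    rw [← hgh, hh, sumZeroRep_coPoint]
  -- `S_k` is 2-transitive. If the common value were 0, the span would be totally isotropic.
  have hconst : ∀ i j i' j', i ≠ j → i' ≠ j' → f (q i) (q j) = f (q i') (q j') := by
    intro i j i' j' h h'
    obtain ⟨σ, rfl, rfl⟩ := exists_perm_apply_eq h h'
    obtain ⟨g, hg, hgq⟩ := hperm σ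
    rw [← hgq, ← hgq, form_apply_of_mem_closure hf hg]
  have hone : ∀ i j, i ≠ j → f (q i) (q j) = 1 := by
    intro i j hij
    refine eq_one_of_ne_zero fun h0 => hne ?_
    have hz : ∀ i' j', f (q i') (q j') = 0 := by
      intro i' j'
      by_cases h : i' = j'
      · rw [h]
        exact hf _
      · rw [← h0]
        exact hconst _ _ _ _ h hij
    rw [eq_bot_iff]
    intro x hx
    refine Submodule.disjoint_def.1 hdis x hx fun w hw => ?_
    obtain ⟨y, rfl⟩ := hspan x hx
    obtain ⟨z, rfl⟩ := hspan w hw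
    change f _ _ = 0
    simp [hz, LinearMap.sum_apply]
  have hstar : IsStar f q := by
    intro i j
    split_ifs with h
    · rw [h]
      exact hf _
    · exact hone i j h
  refine ⟨k, q, hstar, fun c hc => ⟨fun hmem => ?_, ?_⟩⟩
  · have hcW : c ∈ W := by
      obtain ⟨x, hx⟩ := exists_form_ne_zero hnd hc
      rw [hW, ← commutatorSpace_closure_formTransvection hf hnd B]
      refine Submodule.subset_span ⟨_, hmem, x, ?_⟩
      rw [formTransvection_apply, hx, one_smul, add_sub_cancel_left]
    obtain ⟨σ, hσ⟩ := (hG _).1 (restrict_formTransvection_mem hf hcW hmem)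
    have hσ' : ∀ i, q i + f (q i) c • c = q (σ i) := by
      intro i
      have := congrArg Subtype.val (hσ (coPoint hk i))
      rw [sumZeroRep_coPoint] at this
      exact this
    -- The transvection of `c` permutes the `q i`; one not orthogonal to `c` moves to `q i + c`,
    -- itself a member of the family.
    obtain ⟨i, hi⟩ : ∃ i, f (q i) c = 1 := by
      by_contra! h
      refine hc (Submodule.disjoint_def.1 hdis c hcW fun w hw => ?_)
      obtain ⟨z, rfl⟩ := hspan w hw
      have hz : ∀ i, f (q i) c = 0 := fun i => by
        by_contra h0
        exact h i (eq_one_of_ne_zero h0)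
      change f _ _ = 0
      simp [hz, LinearMap.sum_apply]
    have h := hσ' i
    rw [hi, one_smul] at h
    refine ⟨i, σ i, fun hfix => hc ?_, ?_⟩
    · rw [← hfix] at h
      simpa using h
    · rw [← h, ← add_assoc, add_self, zero_add]
  · rintro ⟨i, j, hij, rfl⟩
    obtain ⟨g, hg, hgq⟩ := hperm (Equiv.swap i j)
    suffices formTransvection hf (q i + q j) = g by rwa [this]
    have hqW : ∀ l, q l ∈ W := fun l => (Φ (coPoint hk l)).2
    have hcompl := (LinearMap.BilinForm.isCompl_orthogonal_iff_disjoint hf.isRefl).2 hdis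
    have hq : ∀ l, formTransvection hf (q i + q j) (q l) = g (q l) := by
      intro l
      rw [hgq, formTransvection_apply, map_add, hstar, hstar]
      by_cases hli : l = i
      · subst hli
        simp [hij, ← add_assoc, add_self]
      · by_cases hlj : l = j
        · subst hlj
          simp [hli, add_left_comm, add_self]
        · simp [hli, hlj, Equiv.swap_apply_of_ne_of_ne, CharTwo.add_self_eq_zero]
    -- Both maps agree on the `q l`, hence on `W`, and both fix the orthogonal complement of `W`
    -- pointwise.
    ext x
    obtain ⟨w, hw, o, ho, rfl⟩ := Submodule.mem_sup.1
      (hcompl.sup_eq_top ▸ Submodule.mem_top : x ∈ W ⊔ f.orthogonal W)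
    rw [map_add, map_add, apply_eq_of_mem_orthogonal hf hg ho]
    congr 1
    · obtain ⟨y, rfl⟩ := hspan w hw
      simp only [map_sum, map_smul, hq]
    · have : f (q i + q j) o = 0 := ho _ (W.add_mem (hqW i) (hqW j))
      rw [formTransvection_apply, form_comm hf, this, zero_smul, add_zero]

end PairSystem

/-! ### From a spanning star to symmetric type -/

section Global

/-- A group generated by transvections whose vectors are members, or sums of two members, of a
spanning set of pairwise non-orthogonal vectors has symmetric type. -/
theorem hasSymmetricType_of_star [FiniteDimensional (ZMod 2) V] (hf : f.IsAlt)
    (hnd : f.Nondegenerate) {T : Set (V ≃ₗ[ZMod 2] V)} {r : ℕ} {x : Fin r → V} (hx : IsStar f x)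
    (hspan : Submodule.span (ZMod 2) (Set.range x) = ⊤)
    (hxT : ∀ i, formTransvection hf (x i) ∈ Subgroup.closure T)
    (hT : ∀ t ∈ T, (∃ i, t = formTransvection hf (x i)) ∨
      ∃ i j, i ≠ j ∧ t = formTransvection hf (x i + x j)) :
    HasSymmetricType (Subgroup.closure T) := by
  -- With the extra point `q 0 = 0`, each `x i` becomes a pair `q 0 + q i.succ`, so all generators
  -- are sums of two points.
  let q : Fin (r + 1) → V := Fin.cons 0 x
  have hq0 : q 0 = 0 := rfl
  have hqs : ∀ i : Fin r, q i.succ = x i := fun i => rfl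
  let Φ : sumZero (r + 1) →ₗ[ZMod 2] V :=
    (Fintype.linearCombination (ZMod 2) q).comp (sumZero (r + 1)).subtype
  have hΦ : ∀ y : sumZero (r + 1), Φ y = ∑ i, (y : Fin (r + 1) → ZMod 2) i • q i := fun y => rfl
  have hΦpair : ∀ i j, Φ (pairVec i j) = q i + q j := by
    intro i j
    simp [hΦ, pairVec_apply, add_smul, Finset.sum_add_distrib]
  -- This formula shows that transvections of pairs act as transpositions and that `ker Φ` consists
  -- of the constant vectors.
  have hform : ∀ (y : sumZero (r + 1)) j, f (Φ y) (q j) =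
      (y : Fin (r + 1) → ZMod 2) 0 + (y : Fin (r + 1) → ZMod 2) j := by
    intro y j
    have hy : ∑ i, (y : Fin (r + 1) → ZMod 2) i = 0 := y.2
    rw [hΦ, map_sum, LinearMap.sum_apply]
    refine Fin.cases ?_ (fun j => ?_) j
    · simp [hq0, CharTwo.add_self_eq_zero]
    · rw [Fin.sum_univ_succ] at hy ⊢
      have h1 : ∀ i : Fin r, f ((y : Fin (r + 1) → ZMod 2) i.succ • q i.succ) (q j.succ) =
          (y : Fin (r + 1) → ZMod 2) i.succ +
            if i = j then (y : Fin (r + 1) → ZMod 2) i.succ else 0 := by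
        intro i
        rw [hqs, hqs, map_smul, LinearMap.smul_apply, hx]
        split_ifs with h
        · simp [CharTwo.add_self_eq_zero]
        · simp
      rw [Finset.sum_congr rfl fun i _ => h1 i, Finset.sum_add_distrib, hq0]
      simp only [smul_zero, map_zero, LinearMap.zero_apply, zero_add, Finset.sum_ite_eq',
        Finset.mem_univ, if_true]
      congr 1
      exact (CharTwo.add_eq_zero.1 hy).symm
  have hswap : ∀ i j, i ≠ j → ∀ y, formTransvection hf (q i + q j) (Φ y) =
      Φ (sumZeroRep (r + 1) (Equiv.swap i j) y) := by
    intro i j hij y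
    rw [sumZeroRep_swap hij, map_add, map_smul, hΦpair, formTransvection_apply, map_add, hform,
      hform]
    congr 2
    rw [add_add_add_comm, CharTwo.add_self_eq_zero, zero_add]
  refine ⟨r + 1, isSymmetricOfDegree_of_swaps Φ ?_ ?_ ?_ ?_⟩
  · rw [← LinearMap.range_eq_top, eq_top_iff, ← hspan]
    refine Submodule.span_le.2 ?_
    rintro _ ⟨i, rfl⟩
    exact ⟨pairVec 0 i.succ, by rw [hΦpair, hq0, hqs, zero_add]⟩
  · ext y
    rw [LinearMap.mem_ker, mem_allOnesIn]
    constructor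
    · intro h
      have h0 : ∀ i, (y : Fin (r + 1) → ZMod 2) 0 = (y : Fin (r + 1) → ZMod 2) i := by
        intro i
        rw [← CharTwo.add_eq_zero, ← hform, h, map_zero, LinearMap.zero_apply]
      exact fun i j => (h0 i).symm.trans (h0 j)
    · intro h
      refine hnd.1 _ fun v => ?_
      have hle : Submodule.span (ZMod 2) (Set.range x) ≤ LinearMap.ker (f (Φ y)) := by
        refine Submodule.span_le.2 ?_
        rintro _ ⟨i, rfl⟩
        change f (Φ y) (q i.succ) = 0
        rw [hform, h 0 i.succ, CharTwo.add_self_eq_zero]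
      rw [hspan] at hle
      exact hle Submodule.mem_top
  · intro g hg
    obtain ⟨σ, -, hσ⟩ := exists_perm_of_mem_closure Φ ⊤ (fun t ht => by
      rcases hT t ht with ⟨i, rfl⟩ | ⟨i, j, hij, rfl⟩
      · refine ⟨Equiv.swap 0 i.succ, Subgroup.mem_top _, fun y => ?_⟩
        rw [← hswap _ _ (Fin.succ_ne_zero i).symm, hq0, hqs, zero_add]
      · refine ⟨Equiv.swap i.succ j.succ, Subgroup.mem_top _, fun y => ?_⟩
        rw [← hswap _ _ ((Fin.succ_injective _).ne hij), hqs, hqs]) hg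
    exact ⟨σ, hσ⟩
  · intro i j hij
    refine ⟨formTransvection hf (q i + q j), ?_, hswap i j hij⟩
    induction i using Fin.cases with
    | zero =>
      induction j using Fin.cases with
      | zero => exact absurd rfl hij
      | succ j =>
        rw [hq0, zero_add]
        exact hxT j
    | succ i =>
      induction j using Fin.cases with
      | zero =>
        rw [hq0, add_zero]
        exact hxT i
      | succ j =>
        refine formTransvection_add_mem hf (hxT i) (hxT j) ?_
        rw [hqs, hqs, hx, if_neg fun h => hij (by rw [h])]

end Global

end SymType

/-! ### The local condition implies symmetric type -/

namespace SymType

variable {V : Type*} [AddCommGroup V] [Module (ZMod 2) V]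
  {f : LinearMap.BilinForm (ZMod 2) V}

/-- Every subset of `T` of size at most `N` that acts irreducibly on its commutator space
generates there a group of odd symmetric type. -/
def IsLocallyOddSymmetric (T : Set (V ≃ₗ[ZMod 2] V)) (N : ℕ) : Prop :=
  ∀ T₀ : Finset (V ≃ₗ[ZMod 2] V), (T₀ : Set (V ≃ₗ[ZMod 2] V)) ⊆ T → T₀.card ≤ N →
    ∀ (G₀ : Subgroup (V ≃ₗ[ZMod 2] V)) (V₀ : Submodule (ZMod 2) V),
      G₀ = Subgroup.closure (T₀ : Set (V ≃ₗ[ZMod 2] V)) →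
      V₀ = commutatorSpace G₀ →
      2 ≤ Module.finrank (ZMod 2) V₀ →
      (naturalRep (restrictTo G₀ V₀)).IsIrreducible →
      HasOddSymmetricType (restrictTo G₀ V₀)

theorem two_le_finrank_of_disjoint_orthogonal [FiniteDimensional (ZMod 2) V] (hf : f.IsAlt)
    {W : Submodule (ZMod 2) V} (hdis : Disjoint W (f.orthogonal W)) (hne : W ≠ ⊥) :
    2 ≤ Module.finrank (ZMod 2) W := by
  have h0 : Module.finrank (ZMod 2) W ≠ 0 := fun h => hne (Submodule.finrank_eq_zero.1 h)
  have h1 : Module.finrank (ZMod 2) W ≠ 1 := by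
    intro h
    obtain ⟨⟨u, hu⟩, hu0, hspan⟩ := finrank_eq_one_iff'.1 h
    refine hu0 (Subtype.ext (Submodule.disjoint_def.1 hdis u hu fun w hw => ?_))
    obtain ⟨c, hc⟩ := hspan ⟨w, hw⟩
    have hc : c • u = w := congrArg Subtype.val hc
    change f w u = 0
    rw [← hc, map_smul, LinearMap.smul_apply, hf u, smul_zero]
  lia

open Classical in
/-- A small linked set of transvection vectors is contained in a star system. -/
theorem exists_isStar_of_isLinked [FiniteDimensional (ZMod 2) V] (hf : f.IsAlt)
    (hnd : f.Nondegenerate) {T : Set (V ≃ₗ[ZMod 2] V)}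
    (hS : ∀ r, r ≠ 0 → ∃ u, formTransvection hf u ∈ T ∧ f u r = 1) {N : ℕ}
    (hloc : IsLocallyOddSymmetric T N) {A : Finset V}
    (hAT : ∀ u ∈ A, formTransvection hf u ∈ T) (hA : IsLinked f A) {a : V} (haA : a ∈ A)
    (ha : a ≠ 0) (hcard : 2 * A.card ≤ N) :
    ∃ B : Finset V, A ⊆ B ∧ (∀ u ∈ B, formTransvection hf u ∈ T) ∧ IsLinked f B ∧
      B.card ≤ 2 * A.card ∧ ∃ (k : ℕ) (q : Fin k → V), IsStar f q ∧ ∀ c, c ≠ 0 →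
        (formTransvection hf c ∈ Subgroup.closure (formTransvection hf '' (B : Set V)) ↔
          ∃ i j, i ≠ j ∧ c = q i + q j) := by
  -- The radical of the span of `A` has dimension at most `|A|`, so at most `|A|` vectors are added.
  obtain ⟨B, hAB, hBT, hB, hBcard, hdis⟩ := exists_linked_disjoint_orthogonal hf
    (S := {u | formTransvection hf u ∈ T}) hS A.card A hAT hA
    ((Submodule.finrank_mono inf_le_left).trans (finrank_span_finset_le_card A))
  have hne : Submodule.span (ZMod 2) (B : Set V) ≠ ⊥ := fun h => by
    rw [Submodule.span_eq_bot] at h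
    exact ha (h a (hAB haA))
  refine ⟨B, hAB, hBT, hB, by lia, ?_⟩
  refine exists_isStar_of_hasOddSymmetricType hf hnd hdis hne ?_
  refine hloc (B.image (formTransvection hf)) ?_ ?_ _ _ ?_ ?_ ?_ ?_
  · rw [Finset.coe_image, Set.image_subset_iff]
    exact hBT
  · exact Finset.card_image_le.trans (by lia)
  · rw [Finset.coe_image]
  · rw [commutatorSpace_closure_formTransvection hf hnd]
  · exact two_le_finrank_of_disjoint_orthogonal hf hdis hne
  · exact isIrreducible_of_isLinked hf hB hdis hne

open Classical in
theorem hasSymmetricType_of_isLocallyOddSymmetric [FiniteDimensional (ZMod 2) V]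
    [Nontrivial V] (hf : f.IsAlt) (hnd : f.Nondegenerate) {T : Set (V ≃ₗ[ZMod 2] V)}
    (hT : ∀ t ∈ T, ∃ u ≠ 0, t = formTransvection hf u)
    (hS : ∀ v w, v ≠ 0 → w ≠ 0 → ∃ u, formTransvection hf u ∈ T ∧ f u v = 1 ∧ f u w = 1)
    (hloc : IsLocallyOddSymmetric T 32) : HasSymmetricType (Subgroup.closure T) := by
  have hS' : ∀ r, r ≠ 0 → ∃ u, formTransvection hf u ∈ T ∧ f u r = 1 := fun r hr => by
    obtain ⟨u, hu, h, -⟩ := hS r r hr hr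
    exact ⟨u, hu, h⟩
  have hne_of_form : ∀ {u v : V}, f u v = 1 → u ≠ 0 := by
    rintro u v h rfl
    simp at h
  obtain ⟨v, hv⟩ := exists_ne (0 : V)
  obtain ⟨a, haT, hav⟩ := hS' v hv
  have ha := hne_of_form hav
  obtain ⟨b, hbT, hba⟩ := hS' a ha
  have hab : f a b = 1 := by rw [form_comm hf, hba]
  have hb := hne_of_form hba
  -- The condition in terms of `a` and `b` singles out the pairs through `p` in any local system
  -- containing both.
  let X : Set V := {c | c ≠ 0 ∧ (c = a ∨ c = b ∨ (f c a = 1 ∧ f c b = 1 ∧ c ≠ a + b)) ∧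
    ∃ B : Finset V, a ∈ B ∧ b ∈ B ∧ (∀ u ∈ B, formTransvection hf u ∈ T) ∧ IsLinked f B ∧
      B.card ≤ 8 ∧ formTransvection hf c ∈ Subgroup.closure (formTransvection hf '' (B : Set V))}
  have hclique : ∀ c ∈ X, ∀ c' ∈ X, c ≠ c' → f c c' = 1 := by
    rintro c ⟨hc0, hc, A, haA, hbA, hAT, hA, hA8, hcA⟩ c'
      ⟨hc0', hc', A', haA', hbA', hAT', hA', hA8', hcA'⟩ hne
    -- Two sets of at most 8 vectors, both containing `a`, have a linked union of at most 16;
    -- doubling gives the bound 32.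
    obtain ⟨B, hAB, hBT, hB, hBcard, k, q, hq, hpair⟩ := exists_isStar_of_isLinked hf hnd hS' hloc
      (A := A ∪ A') (fun u hu => (Finset.mem_union.1 hu).elim (hAT u) (hAT' u))
      (hA.union hA' haA haA') (Finset.mem_union_left _ haA) ha
      (by have := Finset.card_union_le A A'; lia)
    have hmono : ∀ {C : Finset V} {w : V}, C ⊆ B → w ≠ 0 →
        formTransvection hf w ∈ Subgroup.closure (formTransvection hf '' (C : Set V)) →
        ∃ i j, i ≠ j ∧ w = q i + q j := fun hCB hw0 hw => (hpair _ hw0).1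
      (Subgroup.closure_mono (Set.image_mono (Finset.coe_subset.2 hCB)) hw)
    have hAB1 := Finset.union_subset_left hAB
    have hAB2 := Finset.union_subset_right hAB
    obtain ⟨i, j, hij, haq⟩ := hmono hAB1 ha (Subgroup.subset_closure ⟨a, haA, rfl⟩)
    obtain ⟨i', j', hij', hbq⟩ := hmono hAB1 hb (Subgroup.subset_closure ⟨b, hbA, rfl⟩)
    have hab' := hab
    rw [haq, hbq] at hab'
    obtain ⟨p, s, t, hps, hpt, hst, h1, h2⟩ := hq.exists_common hij hij' hab'
    rw [h1] at haq
    rw [h2] at hbq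
    have hform : ∀ w, (w = a ∨ w = b ∨ (f w a = 1 ∧ f w b = 1 ∧ w ≠ a + b)) →
        (∃ i j, i ≠ j ∧ w = q i + q j) → ∃ z, p ≠ z ∧ w = q p + q z := by
      rintro w (rfl | rfl | ⟨hwa, hwb, hwab⟩) ⟨x, y, hxy, hw⟩
      · exact ⟨s, hps, haq⟩
      · exact ⟨t, hpt, hbq⟩
      · rw [hw, haq] at hwa
        rw [hw, hbq] at hwb
        rw [hw]
        refine hq.exists_eq_add hps hpt hst hxy hwa hwb fun h => hwab ?_
        rw [hw, h, haq, hbq, add_add_add_comm, add_self, zero_add]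
    obtain ⟨z, hz, rfl⟩ := hform c hc (hmono hAB1 hc0 hcA)
    obtain ⟨z', hz', rfl⟩ := hform c' hc' (hmono hAB2 hc0' hcA')
    have hzz : z ≠ z' := fun h => hne (by rw [h])
    rw [hq.form_pair]
    simp [hz', hz.symm, hzz, CharTwo.add_self_eq_zero]
  have hgen : ∀ r, formTransvection hf r ∈ T → r ≠ 0 →
      r ∈ X ∨ ∃ c ∈ X, ∃ c' ∈ X, c ≠ c' ∧ r = c + c' := by
    intro r hrT hr
    -- Density links `r` to `a` through `u`; the set `{r, u, b, a}` then grows to at most 8 vectors.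
    obtain ⟨u, huT, hur, hua⟩ := hS r a hr ha
    have hlink : IsLinked f (insert r (insert u (insert b {a}))) :=
      (((isLinked_singleton a).insert hf (Finset.mem_singleton_self a) hab).insert hf (w := a)
        (by simp) (by rw [form_comm hf, hua])).insert hf (Finset.mem_insert_self _ _) hur
    obtain ⟨B, hAB, hBT, hB, hBcard, k, q, hq, hpair⟩ := exists_isStar_of_isLinked hf hnd hS' hloc
      (A := insert r (insert u (insert b {a}))) (by
        simp only [Finset.mem_insert, Finset.mem_singleton]
        rintro w (rfl | rfl | rfl | rfl) <;> assumption) hlink (a := a) (by simp) ha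
      (by have := Finset.card_le_four (a := r) (b := u) (c := b) (d := a); lia)
    have hB8 : B.card ≤ 8 := by
      have := Finset.card_le_four (a := r) (b := u) (c := b) (d := a)
      lia
    have haB : a ∈ B := hAB (by simp)
    have hbB : b ∈ B := hAB (by simp)
    have hrB : r ∈ B := hAB (by simp)
    obtain ⟨i, j, hij, haq⟩ := (hpair a ha).1 (Subgroup.subset_closure ⟨a, haB, rfl⟩)
    obtain ⟨i', j', hij', hbq⟩ := (hpair b hb).1 (Subgroup.subset_closure ⟨b, hbB, rfl⟩)
    obtain ⟨x, y, hxy, hrq⟩ := (hpair r hr).1 (Subgroup.subset_closure ⟨r, hrB, rfl⟩)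
    have hab' := hab
    rw [haq, hbq] at hab'
    obtain ⟨p, s, t, hps, hpt, hst, h1, h2⟩ := hq.exists_common hij hij' hab'
    rw [h1] at haq
    rw [h2] at hbq
    have hinj : ∀ {z z' : Fin k}, z ≠ z' → q z ≠ q z' := by
      intro z z' hz h
      have := hq z z'
      rw [if_neg hz, h, hf] at this
      exact zero_ne_one this
    have hX : ∀ z, p ≠ z → q p + q z ∈ X := by
      intro z hz
      have hne : q p + q z ≠ 0 := fun h => hinj hz (by
        rw [← add_self (q z)] at h
        exact add_right_cancel h)
      refine ⟨hne, ?_, B, haB, hbB, hBT, hB, hB8, (hpair _ hne).2 ⟨p, z, hz, rfl⟩⟩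
      by_cases hzs : z = s
      · exact Or.inl (by rw [hzs, haq])
      by_cases hzt : z = t
      · exact Or.inr (Or.inl (by rw [hzt, hbq]))
      refine Or.inr (Or.inr ⟨?_, ?_, fun h => ?_⟩)
      · rw [haq, hq.form_pair]
        simp [hps, hz.symm, hzs, CharTwo.add_self_eq_zero]
      · rw [hbq, hq.form_pair]
        simp [hpt, hz.symm, hzt, CharTwo.add_self_eq_zero]
      · have h' := congrArg (fun w => f w (q p)) h
        simp [haq, hbq, hq _ _, hz.symm, hps.symm, hpt.symm, CharTwo.add_self_eq_zero] at h'
    by_cases hxp : x = p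
    · exact Or.inl (by rw [hrq, hxp]; exact hX y (hxp ▸ hxy))
    by_cases hyp : y = p
    · exact Or.inl (by rw [hrq, hyp, add_comm]; exact hX x (Ne.symm hxp))
    refine Or.inr ⟨_, hX x (Ne.symm hxp), _, hX y (Ne.symm hyp), fun h => hinj hxy ?_, ?_⟩
    · exact add_left_cancel h
    · rw [hrq, add_add_add_comm, add_self, zero_add]
  have : Finite V := Module.finite_of_finite (ZMod 2)
  obtain ⟨r, ⟨e⟩⟩ := Finite.exists_equiv_fin X
  have hrange : Set.range (fun i => (e.symm i : V)) = X := by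
    ext c
    exact ⟨by rintro ⟨i, rfl⟩; exact (e.symm i).2, fun hc => ⟨e ⟨c, hc⟩, by simp⟩⟩
  refine hasSymmetricType_of_star hf hnd (x := fun i => (e.symm i : V)) ?_ ?_ ?_ ?_
  · intro i j
    split_ifs with h
    · rw [h]
      exact hf _
    · exact hclique _ (e.symm i).2 _ (e.symm j).2 fun h' => h (e.symm.injective (Subtype.ext h'))
  · rw [hrange]
    -- `X` spans because every vector of `T` lies in its span, while no nonzero `w` is orthogonal to
    -- all of them.
    rw [← LinearMap.BilinForm.orthogonal_orthogonal hnd hf.isRefl (Submodule.span _ X)]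
    suffices f.orthogonal (Submodule.span (ZMod 2) X) = ⊥ by
      rw [this, LinearMap.BilinForm.orthogonal_bot]
    rw [eq_bot_iff]
    intro w hw
    by_contra hw0
    obtain ⟨u, huT, huw⟩ := hS' w hw0
    have hu : u ∈ Submodule.span (ZMod 2) X := by
      rcases hgen u huT (hne_of_form huw) with h | ⟨c, hc, c', hc', -, rfl⟩
      · exact Submodule.subset_span h
      · exact Submodule.add_mem _ (Submodule.subset_span hc) (Submodule.subset_span hc')
    exact one_ne_zero (huw.symm.trans (hw u hu))
  · intro i
    obtain ⟨-, -, B, -, -, hBT, -, -, hB⟩ := (e.symm i).2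
    refine Subgroup.closure_mono ?_ hB
    rintro _ ⟨u, hu, rfl⟩
    exact hBT u hu
  · intro t ht
    obtain ⟨u, hu0, rfl⟩ := hT t ht
    rcases hgen u ht hu0 with h | ⟨c, hc, c', hc', hne, rfl⟩
    · exact Or.inl ⟨e ⟨u, h⟩, by simp⟩
    · exact Or.inr ⟨e ⟨c, hc⟩, e ⟨c', hc'⟩, fun h => hne (by simpa using h), by simp⟩

end SymType

namespace SymType

variable {V : Type*} [AddCommGroup V] [Module (ZMod 2) V]
  {f : LinearMap.BilinForm (ZMod 2) V} {m : ℕ}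

/-! ### Permutations acting as transvections, and extension by zero -/

section Swaps

theorem pairVec_self (i : Fin m) : pairVec i i = 0 := by
  ext x
  rw [pairVec_apply, CharTwo.add_self_eq_zero]
  rfl

theorem sum_smul_pairVec (y : sumZero m) (p : Fin m) :
    ∑ x, (y : Fin m → ZMod 2) x • pairVec x p = y := by
  ext x
  have hy : ∑ i, (y : Fin m → ZMod 2) i = 0 := y.2
  simp only [AddSubmonoidClass.coe_finsetSum, Submodule.coe_smul, Finset.sum_apply, Pi.smul_apply,
    smul_eq_mul, pairVec_apply, mul_add, Finset.sum_add_distrib, ← Finset.sum_mul, hy, zero_mul,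
    add_zero]
  simp

/-- The difference lies in `ker Φ`, so it is constant, and it vanishes at `z`. -/
theorem eq_of_map_eq_of_apply_eq {Φ : sumZero m →ₗ[ZMod 2] V}
    (hker : LinearMap.ker Φ = allOnesIn m) {y y' : sumZero m} (h : Φ y = Φ y') {z : Fin m}
    (hz : (y : Fin m → ZMod 2) z = (y' : Fin m → ZMod 2) z) : y = y' := by
  have hmem : y - y' ∈ allOnesIn m := by rw [← hker, LinearMap.mem_ker, map_sub, h, sub_self]
  ext x
  have := mem_allOnesIn.1 hmem x z
  simp only [Submodule.coe_sub, Pi.sub_apply, hz, sub_self] at this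
  exact sub_eq_zero.1 this

theorem pairVec_eq_of_map_eq (hm : 5 ≤ m) {Φ : sumZero m →ₗ[ZMod 2] V}
    (hker : LinearMap.ker Φ = allOnesIn m) {a b c d : Fin m}
    (h : Φ (pairVec a b) = Φ (pairVec c d)) : pairVec a b = pairVec c d := by
  obtain ⟨z, hz⟩ : ∃ z, z ∉ ({a, b, c, d} : Finset (Fin m)) := by
    by_contra! hall
    have h1 : Finset.univ ⊆ ({a, b, c, d} : Finset (Fin m)) := fun x _ => hall x
    have h2 := Finset.card_le_card h1
    have h3 := Finset.card_le_four (a := a) (b := b) (c := c) (d := d)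
    rw [Finset.card_univ, Fintype.card_fin] at h2
    lia
  simp only [Finset.mem_insert, Finset.mem_singleton, not_or] at hz
  refine eq_of_map_eq_of_apply_eq hker h (z := z) ?_
  simp [pairVec_apply, hz]

/-- A permutation acting as a transvection is a transposition. -/
theorem exists_eq_swap (hm : 5 ≤ m) {Φ : sumZero m →ₗ[ZMod 2] V}
    (hker : LinearMap.ker Φ = allOnesIn m) {σ : Equiv.Perm (Fin m)} (hσ : σ ≠ 1) {u : V}
    (h : ∀ y, Φ (sumZeroRep m σ y) = Φ y ∨ Φ (sumZeroRep m σ y) = Φ y + u) :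
    ∃ i j, i ≠ j ∧ σ = Equiv.swap i j := by
  -- The images of the displacements `e_i + e_{σ i}` take at most two values, differing by `u`.
  have hD : ∀ i j, Φ (pairVec j (σ j)) = Φ (pairVec i (σ i)) ∨
      Φ (pairVec j (σ j)) = Φ (pairVec i (σ i)) + u := by
    intro i j
    have hsum : pairVec j (σ j) = pairVec i (σ i) + (sumZeroRep m σ (pairVec i j) + pairVec i j) := by
      rw [sumZeroRep_pairVec]
      ext x
      simp only [Submodule.coe_add, Pi.add_apply, pairVec_apply]
      have : ∀ a b c d : ZMod 2, b + d = a + c + (c + d + (a + b)) := by decide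
      exact this _ _ _ _
    rw [hsum, map_add, map_add]
    rcases h (pairVec i j) with h | h
    · left
      rw [h, add_self, add_zero]
    · right
      rw [h, add_right_comm, add_self, zero_add]
  have hne : ∀ {i j}, j ≠ i → j ≠ σ i → σ j ≠ j → Φ (pairVec j (σ j)) ≠ Φ (pairVec i (σ i)) := by
    intro i j h1 h2 h3 heq
    have := congrArg (fun y : sumZero m => (y : Fin m → ZMod 2) j)
      (pairVec_eq_of_map_eq hm hker heq)
    simp [pairVec_apply, h1, h2, h3.symm] at this
  -- Without fixed points, `m ≥ 5` yields three indices with distinct displacements in `V`, too many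
  -- for two values. A fixed point has displacement 0, so every moved point has displacement `u`.
  obtain ⟨p, hp⟩ : ∃ p, σ p = p := by
    by_contra! hfix
    have hout : ∀ s : Finset (Fin m), s.card ≤ 4 → ∃ z, z ∉ s := by
      intro s hs
      by_contra! hall
      have h2 := Finset.card_le_card (fun x _ => hall x : Finset.univ ⊆ s)
      rw [Finset.card_univ, Fintype.card_fin] at h2
      lia
    let i : Fin m := ⟨0, by lia⟩
    obtain ⟨j, hj⟩ := hout {i, σ i} (Finset.card_le_two.trans (by lia))
    obtain ⟨l, hl⟩ := hout {i, σ i, j, σ j} Finset.card_le_four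
    simp only [Finset.mem_insert, Finset.mem_singleton, not_or] at hj hl
    have h1 := (hD i j).resolve_left (hne hj.1 hj.2 (hfix j))
    have h2 := (hD i l).resolve_left (hne hl.1 hl.2.1 (hfix l))
    exact hne hl.2.2.1 hl.2.2.2 (hfix l) (h2.trans h1.symm)
  have hmoved : ∀ {i}, σ i ≠ i → Φ (pairVec i (σ i)) = u := by
    intro i hi
    have hpi : i ≠ p := fun h => hi (by rw [h, hp])
    have := (hD p i).resolve_left (hne hpi (by rwa [hp]) hi)
    rwa [hp, pairVec_self, map_zero, zero_add] at this
  obtain ⟨i, hi⟩ : ∃ i, σ i ≠ i := by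
    by_contra! hall
    exact hσ (Equiv.ext hall)
  refine ⟨i, σ i, hi.symm, Equiv.ext fun x => ?_⟩
  by_cases hx : x = i
  · rw [hx, Equiv.swap_apply_left]
  have hfix : ∀ x, x ≠ i → x ≠ σ i → σ x = x := by
    intro x hxi hxs
    by_contra hx
    exact hne hxi hxs hx ((hmoved hx).trans (hmoved hi).symm)
  by_cases hxs : x = σ i
  · rw [hxs, Equiv.swap_apply_right]
    by_contra hne'
    have hss : σ (σ i) ≠ σ i := fun h => hi (σ.injective h)
    exact hss (σ.injective (hfix _ hne' hss))
  · rw [Equiv.swap_apply_of_ne_of_ne hx hxs, hfix x hx hxs]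

section Extend

variable {k : ℕ} (c : Fin k ↪o Fin m) (p : Fin m)

/-- Extension of coordinate vectors by zero along `c`, written with the help of a base point. -/
noncomputable def extendVec : sumZero k →ₗ[ZMod 2] sumZero m :=
  (Fintype.linearCombination (ZMod 2) fun a => pairVec (c a) p).comp (sumZero k).subtype

theorem extendVec_eq_sum (y : sumZero k) :
    extendVec c p y = ∑ a, (y : Fin k → ZMod 2) a • pairVec (c a) p := rfl

/-- The base point contributes the coordinate sum of `y`, which is zero, so the choice of `p` is
immaterial. -/
theorem extendVec_apply (y : sumZero k) (x : Fin m) : (extendVec c p y : Fin m → ZMod 2) x =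
    ∑ a, if x = c a then (y : Fin k → ZMod 2) a else 0 := by
  have hy : ∑ i, (y : Fin k → ZMod 2) i = 0 := y.2
  simp only [extendVec_eq_sum, AddSubmonoidClass.coe_finsetSum, Submodule.coe_smul,
    Finset.sum_apply, Pi.smul_apply, smul_eq_mul, pairVec_apply, mul_add, Finset.sum_add_distrib,
    ← Finset.sum_mul, hy, zero_mul, add_zero]
  simp only [mul_ite, mul_one, mul_zero]

theorem extendVec_apply_embed (y : sumZero k) (a : Fin k) :
    (extendVec c p y : Fin m → ZMod 2) (c a) = (y : Fin k → ZMod 2) a := by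
  rw [extendVec_apply]
  simp [c.injective.eq_iff]

theorem extendVec_pairVec (a b : Fin k) :
    extendVec c p (pairVec a b) = pairVec (c a) (c b) := by
  rw [extendVec_eq_sum]
  simp only [pairVec_apply, add_smul, Finset.sum_add_distrib, ite_smul, one_smul, zero_smul,
    Finset.sum_ite_eq', Finset.mem_univ, if_true]
  ext x
  simp only [Submodule.coe_add, Pi.add_apply, pairVec_apply]
  have : ∀ a b c : ZMod 2, a + c + (b + c) = a + b := by decide
  exact this _ _ _

theorem extendVec_swap {a b : Fin k} (hab : a ≠ b) (y : sumZero k) :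
    extendVec c p (sumZeroRep k (Equiv.swap a b) y) =
      sumZeroRep m (Equiv.swap (c a) (c b)) (extendVec c p y) := by
  rw [sumZeroRep_swap hab, sumZeroRep_swap (c.injective.ne hab), map_add, map_smul,
    extendVec_pairVec, extendVec_apply_embed, extendVec_apply_embed]

end Extend

/-- If every generator of a permutation group is realised in a linear group, then so is every
element. -/
theorem exists_equiv_of_mem_closure (Φ : sumZero m →ₗ[ZMod 2] V) {s : Set (Equiv.Perm (Fin m))}
    (G : Subgroup (V ≃ₗ[ZMod 2] V))
    (hs : ∀ σ ∈ s, ∃ g ∈ G, ∀ y, g (Φ y) = Φ (sumZeroRep m σ y))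
    {σ : Equiv.Perm (Fin m)} (hσ : σ ∈ Subgroup.closure s) :
    ∃ g ∈ G, ∀ y, g (Φ y) = Φ (sumZeroRep m σ y) := by
  induction hσ using Subgroup.closure_induction with
  | mem σ hσ => exact hs σ hσ
  | one => exact ⟨1, G.one_mem, fun y => by simp⟩
  | mul σ τ _ _ ihσ ihτ =>
    obtain ⟨g, hg, hgσ⟩ := ihσ
    obtain ⟨k, hk, hkτ⟩ := ihτ
    refine ⟨g * k, G.mul_mem hg hk, fun y => ?_⟩
    rw [LinearEquiv.mul_apply, hkτ, hgσ, map_mul]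
    rfl
  | inv σ _ ih =>
    obtain ⟨g, hg, hgσ⟩ := ih
    refine ⟨g⁻¹, G.inv_mem hg, fun y => ?_⟩
    apply g.injective
    rw [← LinearEquiv.mul_apply, mul_inv_cancel, hgσ, ← Module.End.mul_apply, ← map_mul,
      mul_inv_cancel]
    simp

end Swaps

/-! ### Symmetric type implies the local condition -/

section Restriction

theorem apply_mem_commutatorSpace {G : Subgroup (V ≃ₗ[ZMod 2] V)} {g : V ≃ₗ[ZMod 2] V}
    (hg : g ∈ G) {w : V} (hw : w ∈ commutatorSpace G) : g w ∈ commutatorSpace G := by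
  rw [← sub_add_cancel (g w) w]
  exact Submodule.add_mem _ (Submodule.subset_span ⟨g, hg, w, rfl⟩) hw

theorem exists_mem_restrictTo {G : Subgroup (V ≃ₗ[ZMod 2] V)} {g : V ≃ₗ[ZMod 2] V}
    (hg : g ∈ G) : ∃ h ∈ restrictTo G (commutatorSpace G),
      ∀ w : commutatorSpace G, ((h w : commutatorSpace G) : V) = g w := by
  refine ⟨LinearEquiv.ofLinearMap
    ((g : V →ₗ[ZMod 2] V).restrict fun w hw => apply_mem_commutatorSpace hg hw)
    (((g⁻¹ : V ≃ₗ[ZMod 2] V) : V →ₗ[ZMod 2] V).restrict fun w hw =>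
      apply_mem_commutatorSpace (G.inv_mem hg) hw) ?_ ?_, ⟨g, hg, fun w => rfl⟩, fun w => rfl⟩
  · ext w
    exact congrArg (fun k : V ≃ₗ[ZMod 2] V => k w) (mul_inv_cancel g)
  · ext w
    exact congrArg (fun k : V ≃ₗ[ZMod 2] V => k w) (inv_mul_cancel g)

theorem eq_of_isIrreducible {G : Subgroup (V ≃ₗ[ZMod 2] V)} {V₀ W : Submodule (ZMod 2) V}
    (hirr : (naturalRep (restrictTo G V₀)).IsIrreducible) (hWV : W ≤ V₀)
    (hW : ∀ g ∈ G, ∀ w ∈ W, g w ∈ W) (hne : W ≠ ⊥) : W = V₀ := by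
  let ρ : Subrepresentation (naturalRep (restrictTo G V₀)) :=
    { toSubmodule := W.comap V₀.subtype
      apply_mem_toSubmodule := by
        rintro ⟨h, g, hg, hgh⟩ v hv
        change ((h v : V₀) : V) ∈ W
        rw [hgh]
        exact hW g hg _ hv }
  rcases hirr.eq_bot_or_eq_top ρ with h | h
  · exfalso
    have h : W.comap V₀.subtype = ⊥ := congrArg Subrepresentation.toSubmodule h
    apply hne
    rw [eq_bot_iff]
    intro w hw
    have : (⟨w, hWV hw⟩ : V₀) ∈ W.comap V₀.subtype := hw
    rw [h, Submodule.mem_bot] at this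
    exact congrArg Subtype.val this
  · have h : W.comap V₀.subtype = ⊤ := congrArg Subrepresentation.toSubmodule h
    refine le_antisymm hWV fun v hv => ?_
    have : (⟨v, hv⟩ : V₀) ∈ W.comap V₀.subtype := by rw [h]; exact Submodule.mem_top
    exact this

end Restriction

set_option maxHeartbeats 400000 in
theorem hasOddSymmetricType_of_swaps {Φ : sumZero m →ₗ[ZMod 2] V}
    (hker : LinearMap.ker Φ = allOnesIn m) {T₀ : Finset (V ≃ₗ[ZMod 2] V)}
    (hcard : 2 * T₀.card < m) (I J : (V ≃ₗ[ZMod 2] V) → Fin m)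
    (hIJ : ∀ t ∈ T₀, I t ≠ J t ∧ ∀ y, t (Φ y) = Φ (sumZeroRep m (Equiv.swap (I t) (J t)) y))
    {G₀ : Subgroup (V ≃ₗ[ZMod 2] V)} (hG₀ : G₀ = Subgroup.closure (T₀ : Set (V ≃ₗ[ZMod 2] V)))
    (h2 : 2 ≤ Module.finrank (ZMod 2) (commutatorSpace G₀))
    (hirr : (naturalRep (restrictTo G₀ (commutatorSpace G₀))).IsIrreducible) :
    HasOddSymmetricType (restrictTo G₀ (commutatorSpace G₀)) := by
  classical
  have hT₀ : ∀ t ∈ T₀, t ∈ G₀ := fun t ht => by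
    rw [hG₀]
    exact Subgroup.subset_closure ht
  have hmem : ∀ {g}, g ∈ G₀ → g ∈ Subgroup.closure (T₀ : Set (V ≃ₗ[ZMod 2] V)) := fun hg => by
    rwa [← hG₀]
  -- The transpositions move at most `2 * T₀.card < m` coordinates.
  obtain ⟨z, hz⟩ : ∃ z, z ∉ T₀.image I ∪ T₀.image J := by
    by_contra! hall
    have h1 := Finset.card_le_card (fun x _ => hall x : Finset.univ ⊆ T₀.image I ∪ T₀.image J)
    have h2 := Finset.card_union_le (T₀.image I) (T₀.image J)
    have h3 := Finset.card_image_le (s := T₀) (f := I)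
    have h4 := Finset.card_image_le (s := T₀) (f := J)
    rw [Finset.card_univ, Fintype.card_fin] at h1
    lia
  have hzI : ∀ t ∈ T₀, z ≠ I t := fun t ht h =>
    hz (Finset.mem_union_left _ (h ▸ Finset.mem_image_of_mem I ht))
  have hzJ : ∀ t ∈ T₀, z ≠ J t := fun t ht h =>
    hz (Finset.mem_union_right _ (h ▸ Finset.mem_image_of_mem J ht))
  let s : Set (Equiv.Perm (Fin m)) := (fun t => Equiv.swap (I t) (J t)) '' (T₀ : Set _)
  have hs : ∀ σ ∈ s, σ.IsSwap := by
    rintro _ ⟨t, ht, rfl⟩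
    exact ⟨_, _, (hIJ t ht).1, rfl⟩
  have hlift : ∀ σ ∈ Subgroup.closure s, ∃ g ∈ G₀, ∀ y, g (Φ y) = Φ (sumZeroRep m σ y) :=
    fun σ hσ => exists_equiv_of_mem_closure Φ G₀ (by
      rintro _ ⟨t, ht, rfl⟩
      exact ⟨t, hT₀ t ht, (hIJ t ht).2⟩) hσ
  have hdesc : ∀ g ∈ G₀, ∃ σ ∈ Subgroup.closure s, ∀ y, g (Φ y) = Φ (sumZeroRep m σ y) :=
    fun g hg => exists_perm_of_mem_closure Φ (Subgroup.closure s) (fun t ht =>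
      ⟨Equiv.swap (I t) (J t), Subgroup.subset_closure ⟨t, ht, rfl⟩, (hIJ t ht).2⟩) (hmem hg)
  have hfixz : ∀ σ ∈ Subgroup.closure s, σ z = z := by
    have : Subgroup.closure s ≤ MulAction.stabilizer (Equiv.Perm (Fin m)) z := by
      rw [Subgroup.closure_le]
      rintro _ ⟨t, ht, rfl⟩
      exact Equiv.swap_apply_of_ne_of_ne (hzI t ht) (hzJ t ht)
    exact fun σ hσ => this hσ
  obtain ⟨t₀, ht₀⟩ : T₀.Nonempty := by
    by_contra hemp
    rw [Finset.not_nonempty_iff_eq_empty] at hemp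
    have hbot : commutatorSpace G₀ = ⊥ := by
      rw [eq_bot_iff]
      refine Submodule.span_le.2 ?_
      rintro _ ⟨g, hg, v, rfl⟩
      refine sub_mem_of_mem_closure (fun t ht => ?_) (hmem hg) v
      simp [hemp] at ht
    rw [hbot, finrank_bot] at h2
    lia
  let p := I t₀
  -- For a group generated by transpositions this is the orbit of `p`.
  let C : Finset (Fin m) := Finset.univ.filter fun x => Equiv.swap x p ∈ Subgroup.closure s
  have hC : ∀ {x}, x ∈ C ↔ Equiv.swap x p ∈ Subgroup.closure s := by simp [C]
  have hpC : p ∈ C := by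
    rw [hC, Equiv.swap_self]
    exact Subgroup.one_mem _
  have hzC : z ∉ C := fun h => by
    have := hfixz _ (hC.1 h)
    rw [Equiv.swap_apply_left] at this
    exact hzI t₀ ht₀ this.symm
  have hCinv : ∀ σ ∈ Subgroup.closure s, ∀ x, σ x ∈ C → x ∈ C := by
    intro σ hσ x hx
    rw [hC, swap_mem_closure_isSwap hs] at hx ⊢
    have := MulAction.mem_orbit_of_mem_orbit (⟨σ⁻¹, Subgroup.inv_mem _ hσ⟩ : Subgroup.closure s) hx
    simpa [Subgroup.smul_def] using this
  have hpairmem : ∀ x ∈ C, Φ (pairVec x p) ∈ commutatorSpace G₀ := by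
    intro x hx
    by_cases hxp : x = p
    · rw [hxp, pairVec_self, map_zero]
      exact Submodule.zero_mem _
    · obtain ⟨g, hg, hgs⟩ := hlift _ (hC.1 hx)
      -- As `z ∉ C`, the vector `e_x + e_z` meets `{x, p}` only in `x`, so the swap moves it by `e_x
      -- + e_p`.
      refine Submodule.subset_span ⟨g, hg, Φ (pairVec x z), ?_⟩
      have hxz : x ≠ z := fun h => hzC (h ▸ hx)
      have hpz : p ≠ z := fun h => hzC (h ▸ hpC)
      rw [hgs, sumZeroRep_swap hxp, map_add, add_sub_cancel_left, pairVec_apply, pairVec_apply]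
      simp [hxz, Ne.symm hxp, hpz]
  let L : Submodule (ZMod 2) (sumZero m) :=
    { carrier := {y | ∀ x ∉ C, (y : Fin m → ZMod 2) x = 0}
      zero_mem' := fun x _ => rfl
      add_mem' := fun {a b} ha hb x hx => by
        rw [Submodule.coe_add, Pi.add_apply, ha x hx, hb x hx, add_zero]
      smul_mem' := fun c a ha x hx => by
        rw [Submodule.coe_smul, Pi.smul_apply, ha x hx, smul_zero] }
  have hLsum : ∀ (N : Submodule (ZMod 2) V), (∀ x ∈ C, Φ (pairVec x p) ∈ N) → L.map Φ ≤ N := by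
    rintro N hN _ ⟨y, hy, rfl⟩
    rw [← sum_smul_pairVec y p, map_sum]
    refine Submodule.sum_mem _ fun x _ => ?_
    rw [map_smul]
    by_cases hx : x ∈ C
    · exact Submodule.smul_mem _ _ (hN x hx)
    · rw [hy x hx, zero_smul]
      exact Submodule.zero_mem _
  have hpairL : ∀ {x y}, x ∈ C → y ∈ C → pairVec x y ∈ L := by
    intro x y hx hy w hw
    have h1 : w ≠ x := fun h => hw (h ▸ hx)
    have h2 : w ≠ y := fun h => hw (h ▸ hy)
    simp [pairVec_apply, h1, h2]
  have hJ₀ : J t₀ ∈ C := by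
    rw [hC, Equiv.swap_comm]
    exact Subgroup.subset_closure ⟨t₀, ht₀, rfl⟩
  have hLV : L.map Φ = commutatorSpace G₀ := by
    refine eq_of_isIrreducible hirr (hLsum _ hpairmem) ?_ ?_
    · rintro g hg _ ⟨y, hy, rfl⟩
      obtain ⟨σ, hσ, hgσ⟩ := hdesc g hg
      rw [hgσ]
      refine ⟨_, fun x hx => ?_, rfl⟩
      rw [sumZeroRep_apply]
      refine hy _ fun h => hx (hCinv _ (Subgroup.inv_mem _ hσ) x h)
    · intro hbot
      have hmem : Φ (pairVec p (J t₀)) ∈ L.map Φ := ⟨_, hpairL hpC hJ₀, rfl⟩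
      rw [hbot, Submodule.mem_bot, ← map_zero Φ] at hmem
      have h0 := eq_of_map_eq_of_apply_eq hker hmem (z := z)
        (by simp [pairVec_apply, p, hzI t₀ ht₀, hzJ t₀ ht₀])
      have := congrArg (fun y : sumZero m => (y : Fin m → ZMod 2) p) h0
      simp [pairVec_apply, p, (hIJ t₀ ht₀).1] at this
  -- The image of `e_{I t} + e_{J t}` lies in the commutator space, now known to come from vectors
  -- supported on `C`; injectivity away from `z` places both indices in `C`.
  have hIJC : ∀ t ∈ T₀, I t ∈ C ∧ J t ∈ C := by
    intro t ht
    have hmem : Φ (pairVec (I t) (J t)) ∈ L.map Φ := by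
      rw [hLV]
      refine Submodule.subset_span ⟨t, hT₀ t ht, Φ (pairVec (I t) z), ?_⟩
      rw [(hIJ t ht).2, sumZeroRep_swap (hIJ t ht).1, map_add, add_sub_cancel_left, pairVec_apply,
        pairVec_apply]
      simp [(hzI t ht).symm, (hzJ t ht).symm, (hIJ t ht).1.symm]
    obtain ⟨y, hy, hyp⟩ := hmem
    have hy' := eq_of_map_eq_of_apply_eq hker hyp (z := z)
      (by rw [hy z hzC]; simp [pairVec_apply, hzI t ht, hzJ t ht])
    subst hy'
    constructor
    · by_contra h
      have := hy _ h
      simp [pairVec_apply, (hIJ t ht).1] at this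
    · by_contra h
      have := hy _ h
      simp [pairVec_apply, (hIJ t ht).1.symm] at this
  let c := C.orderEmbOfFin rfl
  have hcC : ∀ a, c a ∈ C := fun a => Finset.orderEmbOfFin_mem C rfl a
  have hcsurj : ∀ x ∈ C, ∃ a, c a = x := fun x hx => by
    have : x ∈ Set.range c := by
      rw [Finset.range_orderEmbOfFin]
      exact hx
    exact this
  let ι : sumZero C.card →ₗ[ZMod 2] sumZero m := extendVec c p
  have hιz : ∀ y : sumZero C.card, (ι y : Fin m → ZMod 2) z = 0 := by
    intro y
    refine (extendVec_apply c p y z).trans (Finset.sum_eq_zero fun a _ => if_neg fun h => ?_)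
    exact hzC (by rw [h]; exact hcC a)
  have hιker : ∀ y, Φ (ι y) = 0 → y = 0 := by
    intro y hy
    rw [← map_zero Φ] at hy
    have h0 := eq_of_map_eq_of_apply_eq hker hy (z := z) (hιz y)
    ext a
    rw [← extendVec_apply_embed c p y a]
    change (ι y : Fin m → ZMod 2) (c a) = 0
    rw [h0]
    rfl
  have hdescι : ∀ g ∈ G₀, ∃ τ : Equiv.Perm (Fin C.card), ∀ y,
      g (Φ (ι y)) = Φ (ι (sumZeroRep _ τ y)) := by
    intro g hg
    obtain ⟨τ, -, hτ⟩ := exists_perm_of_mem_closure (Φ ∘ₗ ι) ⊤ (fun t ht => by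
      obtain ⟨a, ha⟩ := hcsurj _ (hIJC t ht).1
      obtain ⟨b, hb⟩ := hcsurj _ (hIJC t ht).2
      have hab : a ≠ b := fun h => (hIJ t ht).1 (by rw [← ha, ← hb, h])
      refine ⟨Equiv.swap a b, Subgroup.mem_top _, fun y => ?_⟩
      change t (Φ (ι y)) = Φ (ι _)
      rw [(hIJ t ht).2, extendVec_swap c p hab, ha, hb])
      (hmem hg)
    exact ⟨τ, hτ⟩
  have hrange : LinearMap.range (Φ ∘ₗ ι) = commutatorSpace G₀ := by
    apply le_antisymm
    · rintro _ ⟨y, rfl⟩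
      rw [LinearMap.comp_apply, extendVec_eq_sum, map_sum]
      refine Submodule.sum_mem _ fun a _ => ?_
      rw [map_smul]
      exact Submodule.smul_mem _ _ (hpairmem _ (hcC a))
    · rw [← hLV]
      refine hLsum _ fun x hx => ?_
      obtain ⟨a, rfl⟩ := hcsurj x hx
      obtain ⟨b, hb⟩ := hcsurj p hpC
      exact ⟨pairVec a b, by rw [LinearMap.comp_apply, extendVec_pairVec, hb]⟩
  -- For even `|C|` the all-ones vector of `C` spans an invariant line, contradicting irreducibility
  -- in dimension at least 2.
  have hodd : Odd C.card := by
    by_contra hev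
    rw [Nat.not_odd_iff_even] at hev
    let e : sumZero C.card := ⟨fun _ => 1, by
      change ∑ i, _ = _
      simpa using (ZMod.natCast_eq_zero_iff_even).2 hev⟩
    have he : e ≠ 0 := by
      intro h
      obtain ⟨b, hb⟩ := hcsurj p hpC
      exact one_ne_zero (congrFun (congrArg Subtype.val h) b)
    have heV : Submodule.span (ZMod 2) {Φ (ι e)} = commutatorSpace G₀ := by
      refine eq_of_isIrreducible hirr ?_ ?_ ?_
      · rw [Submodule.span_singleton_le_iff_mem, ← hrange]
        exact ⟨e, rfl⟩
      · intro g hg w hw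
        obtain ⟨a, rfl⟩ := Submodule.mem_span_singleton.1 hw
        obtain ⟨τ, hτ⟩ := hdescι g hg
        rw [map_smul, hτ]
        exact hw
      · rw [Ne, Submodule.span_singleton_eq_bot]
        exact fun h => he (hιker e h)
    rw [← heV] at h2
    have := finrank_span_le_card (R := ZMod 2) {Φ (ι e)}
    rw [Set.toFinset_singleton, Finset.card_singleton] at this
    lia
  let Ψ : sumZero C.card →ₗ[ZMod 2] commutatorSpace G₀ :=
    (Φ ∘ₗ ι).codRestrict _ fun y => hrange ▸ LinearMap.mem_range_self _ y
  have hΨ : ∀ y, ((Ψ y : commutatorSpace G₀) : V) = Φ (ι y) := fun y => rfl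
  refine ⟨C.card, hodd, isSymmetricOfDegree_of_swaps Ψ ?_ ?_ ?_ ?_⟩
  · rintro ⟨v, hv⟩
    have hv' := hv
    rw [← hrange] at hv'
    obtain ⟨y, hy⟩ := hv'
    exact ⟨y, Subtype.ext hy⟩
  · ext y
    rw [LinearMap.mem_ker, mem_allOnesIn]
    constructor
    · intro h
      have : y = 0 := hιker y (by rw [← hΨ, h]; rfl)
      subst this
      exact fun _ _ => rfl
    · intro h
      suffices y = 0 by rw [this, map_zero]
      ext a
      have hy : ∑ i, (y : Fin C.card → ZMod 2) i = 0 := y.2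
      rw [Finset.sum_congr rfl fun i _ => h i a, Finset.sum_const, Finset.card_univ,
        Fintype.card_fin, nsmul_eq_mul, (ZMod.natCast_eq_one_iff_odd).2 hodd, one_mul] at hy
      exact hy
  · rintro h ⟨g, hg, hgh⟩
    obtain ⟨τ, hτ⟩ := hdescι g hg
    exact ⟨τ, fun y => Subtype.ext (by rw [hgh, hΨ, hΨ, hτ])⟩
  · intro a b hab
    have hmem : Equiv.swap (c a) (c b) ∈ Subgroup.closure s := by
      refine SubmonoidClass.swap_mem_trans _ (hC.1 (hcC a)) ?_
      rw [Equiv.swap_comm]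
      exact hC.1 (hcC b)
    obtain ⟨g, hg, hgs⟩ := hlift _ hmem
    obtain ⟨h, hh, hhg⟩ := exists_mem_restrictTo hg
    exact ⟨h, hh, fun y => Subtype.ext (by rw [hhg, hΨ, hΨ, hgs, extendVec_swap c p hab])⟩

theorem isLocallyOddSymmetric_of_hasSymmetricType [FiniteDimensional (ZMod 2) V] (hf : f.IsAlt)
    (hnd : f.Nondegenerate) {T : Set (V ≃ₗ[ZMod 2] V)}
    (hT : ∀ t ∈ T, ∃ u ≠ 0, t = formTransvection hf u) {N : ℕ}
    (hn : 2 * N ≤ Module.finrank (ZMod 2) V) (hn4 : 4 ≤ Module.finrank (ZMod 2) V)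
    (hsym : HasSymmetricType (Subgroup.closure T)) : IsLocallyOddSymmetric T N := by
  obtain ⟨m, hm⟩ := hsym
  obtain ⟨Φ, hsurj, hker, hG⟩ := isSymmetricOfDegree_iff.1 hm
  -- `V` is a quotient of `H`, a proper subspace of `𝔽₂^m` when `m > 0`; the case `m = 0`
  -- contradicts `hn4`.
  have hm : Module.finrank (ZMod 2) V < m := by
    have h1 := LinearMap.finrank_le_finrank_of_surjective hsurj
    have h2 : Module.finrank (ZMod 2) (sumZero m) < m := by
      rcases Nat.eq_zero_or_pos m with rfl | hpos
      · have := Submodule.finrank_le (sumZero 0)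
        simp only [Module.finrank_fintype_fun_eq_card, Fintype.card_fin] at this
        lia
      · have hlt : sumZero m ≠ ⊤ := by
          intro h
          have hmem : (Pi.single ⟨0, hpos⟩ 1 : Fin m → ZMod 2) ∈ sumZero m := by
            rw [h]
            exact Submodule.mem_top
          change ∑ i, _ = _ at hmem
          simp at hmem
        have := Submodule.finrank_lt hlt
        simpa using this
    lia
  have hswap : ∀ t ∈ T, ∃ i j, i ≠ j ∧ ∀ y, t (Φ y) = Φ (sumZeroRep m (Equiv.swap i j) y) := by
    intro t ht
    obtain ⟨σ, hσ⟩ := (hG t).1 (Subgroup.subset_closure ht)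
    obtain ⟨u, hu, rfl⟩ := hT t ht
    have hσ1 : σ ≠ 1 := by
      rintro rfl
      obtain ⟨x, hx⟩ := exists_form_ne_zero hnd hu
      obtain ⟨y, rfl⟩ := hsurj x
      have := hσ y
      rw [formTransvection_apply, hx, one_smul, map_one] at this
      exact hu (by simpa using this)
    obtain ⟨i, j, hij, rfl⟩ := exists_eq_swap (by lia) hker hσ1 (u := u) fun y => by
      rw [← hσ, formTransvection_apply]
      by_cases h : f (Φ y) u = 0
      · left
        rw [h, zero_smul, add_zero]
      · right
        rw [eq_one_of_ne_zero h, one_smul]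
    exact ⟨i, j, hij, hσ⟩
  rintro T₀ hT₀ hcard G₀ _ hG₀ rfl h2 hirr
  have : Nonempty (Fin m) := ⟨⟨0, by lia⟩⟩
  choose! I J hIJ using hswap
  exact hasOddSymmetricType_of_swaps hker (by lia) I J (fun t ht => hIJ t (hT₀ ht)) hG₀ h2 hirr

end SymType

theorem mainTheorem7 {V : Type*} [AddCommGroup V] [Module (ZMod 2) V]
    (hn : 2000 ≤ Module.finrank (ZMod 2) V)
    (f : LinearMap.BilinForm (ZMod 2) V) (hf_alt : f.IsAlt) (hf_nondeg : f.Nondegenerate)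
    (T : Set (V ≃ₗ[ZMod 2] V))
    (hT : ∀ t ∈ T, SymType.IsTransvection t)
    (hTf : ∀ t ∈ T, ∀ x y : V, f (t x) (t y) = f x y)
    (hdense : SymType.IsDenseSet T) :
    SymType.HasSymmetricType (Subgroup.closure T) ↔
      ∀ T₀ : Finset (V ≃ₗ[ZMod 2] V), (T₀ : Set (V ≃ₗ[ZMod 2] V)) ⊆ T → T₀.card ≤ 1000 →
        ∀ (G₀ : Subgroup (V ≃ₗ[ZMod 2] V)) (V₀ : Submodule (ZMod 2) V),
          G₀ = Subgroup.closure (T₀ : Set (V ≃ₗ[ZMod 2] V)) →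
          V₀ = SymType.commutatorSpace G₀ →
          2 ≤ Module.finrank (ZMod 2) V₀ →
          (SymType.naturalRep (SymType.restrictTo G₀ V₀)).IsIrreducible →
          SymType.HasOddSymmetricType (SymType.restrictTo G₀ V₀) := by
  have : FiniteDimensional (ZMod 2) V := Module.finite_of_finrank_pos (by lia)
  have : Nontrivial V := Module.nontrivial_of_finrank_pos (R := ZMod 2) (by lia)
  have hT' : ∀ t ∈ T, ∃ u ≠ 0, t = SymType.formTransvection hf_alt u := fun t ht =>
    SymType.exists_eq_formTransvection hf_alt hf_nondeg (hT t ht) (hTf t ht)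
  constructor
  · exact SymType.isLocallyOddSymmetric_of_hasSymmetricType hf_alt hf_nondeg hT' hn (by lia)
  · intro hloc
    exact SymType.hasSymmetricType_of_isLocallyOddSymmetric hf_alt hf_nondeg hT'
      (fun v w hv hw => SymType.exists_mem_of_isDenseSet hf_alt hf_nondeg hT' hdense hv hw)
      fun T₀ hT₀ hcard => hloc T₀ hT₀ (hcard.trans (by norm_num))
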